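/- **PCF** (fine-grained call-by-value): types $T ::= \mathsf{Nat} \mid T\to U$; values $V ::= 0 \mid \mathsf{succ}(V)\mid x\mid \lambda x.C\mid \mathsf{fix}\,f.V$; computations $C ::= V\,W\mid \mathsf{return}(V)\mid \mathsf{let}\,x=C\,\mathsf{in}\,D\mid \mathsf{case}(V;0\mapsto C;\mathsf{succ}(x)\mapsto D)$, with the standard simple typing ($\mathsf{fix}$ only at function types) and reduction: $(\lambda x.C)W\to C[W/x]$; $(\mathsf{fix}\,f.V)W\to (V[\mathsf{fix}\,f.V/f])\,W$; $\mathsf{case}(0;\dots)\to C$; $\mathsf{case}(\mathsf{succ}(V);\dots)\to D[V/x]$; $\mathsf{let}\,x=\mathsf{return}(V)\,\mathsf{in}\,D\to D[V/x]$; and reduction of $C$ inside $\mathsf{let}\,x=C\,\mathsf{in}\,D$. **HEPCF** (finitary): fix finite ground types $B$ with constants $v$, among them $\mathsf{Unit}$ with the single constant $()$, and operation symbols $\sigma: B\rightsquigarrow k$. Types are $B$, the enumeration types $k$ (inhabited by $\underline 0,\dots,\underline{k-1}$) and $T\to_E U$ with $E$ a finite set of operations. Values are constants, $\underline n$, variables,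 $\lambda x.C$, $\mathsf{fix}\,f.V$; computations are $V\,W$, $\sigma(V;x.C)$, $\mathsf{return}(V)$, $\mathsf{let}$, $\mathsf{case}(V;C_1,\dots,C_k)$ and $\mathsf{handle}\,H\,C$ with $H=\{\mathsf{return}(x)\mapsto C_r\}\cup\{\sigma(x;r)\mapsto C_\sigma\mid\sigma\in E'\}$. The judgement $\Gamma\vdash_E C:T$ says that $C$ has type $T$ and uses only operations in $E$; in $\mathsf{handle}\,H\,C$ the computation $C$ uses exactly the effect set $E'$ of handled operations, and $r$ has type $k\to_E T$ where $T$ is the output type. Reduction is that of call-by-value $\lambda$, $\mathsf{fix}$, $\mathsf{case}$ and $\mathsf{let}$, with $\mathsf{let}\,x=\sigma(V;y.C)\,\mathsf{in}\,D\to\sigma(V;y.\mathsf{let}\,x=C\,\mathsf{in}\,D)$ and deep handlers: $\mathsf{handle}\,H\,\mathsf{return}(V)\to C_r[V/x]$, $\mathsf{handle}\,H\,\sigma(V;y.C)\to C_\sigma[V/x,(\lambda y.\mathsf{handle}\,H\,C)/r]$, and reduction of $C$ inside $\mathsf{handle}\,H\,C$. The (possibly infinite) effect tree $ET(C)$ of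 a closed typed computation is $\mathsf{return}(V)$ if $C\to^*\mathsf{return}(V)$; $\sigma(v,ET(D[\underline 0/x]),\dots,ET(D[\underline{k-1}/x]))$ if $C\to^*\sigma(v;x.D)$ with $\sigma : B\rightsquigarrow k$; and $\bot$ if $C$ has no normal form. **Translation.** Let $\sigma:\mathsf{Unit}\rightsquigarrow 1$ and $E=\{\sigma\}$; write $\sigma(y.C)$ for $\sigma(();y.C)$, $\lambda f,g.C$ for $\lambda f.\mathsf{return}(\lambda g.C)$ and $V\,W_1\,W_2$ for $\mathsf{let}\,x=V\,W_1\,\mathsf{in}\,x\,W_2$. Let $Z_{\mathsf{Unit}}=()$, $Z_k=\underline 0$, $Z_{T\to_{E'} U}=\lambda x.\mathsf{return}(Z_U)$ for every effect set $E'$. Put $[\![\mathsf{Nat}]\!]=\mathsf{Unit}\to_E\mathsf{Unit}$, $[\![T\to U]\!]=[\![T]\!]\to_E[\![U]\!]$, $[\![0]\!]=Z_{[\![\mathsf{Nat}]\!]}$, $[\![\mathsf{succ}(V)]\!]=\lambda x.\sigma(y.[\![V]\!]\,())$; variables, $\lambda$, $\mathsf{fix}$, application, $\mathsf{return}$ and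 $\mathsf{let}$ are translated homomorphically, and for $C,D$ of type $T$ $$[\![\mathsf{case}(V;0\mapsto C;\mathsf{succ}(n)\mapsto D)]\!]=\mathsf{let}\,a=\mathsf{handle}\,H(C,D)\,([\![V]\!]\,())\,\mathsf{in}\,a\,(\lambda f,g.\,g\,()),$$ where $H(C,D)$ handles exactly $\sigma$, with the clauses (the parameter of $\sigma$ is unused) $$\mathsf{return}(x)\mapsto\mathsf{return}(\lambda p.\,p\,Z_{\mathsf{Unit}\to_E\mathsf{Unit}}\,(\lambda x.[\![C]\!])),$$ $$\sigma(r)\mapsto \mathsf{let}\,n=\mathsf{return}\big(\lambda x.\,\mathsf{let}\,y=r\,\underline 0\,(\lambda f,g.\,\mathsf{let}\,z=f\,()\,\mathsf{in}\,\mathsf{return}(Z_{[\![T]\!]}))\,\mathsf{in}\,\mathsf{return}(())\big)\,\mathsf{in}\,\mathsf{return}(\lambda p.\,p\,(\lambda x.\sigma(z.\,n\,()))\,(\lambda x.[\![D]\!]))$$ (all bound variables other than $n$ in $D$ are fresh). Since $T$ is taken from the typing, $[\![\cdot]\!]$ is defined on typing derivations. **Theorem.** Let $\vdash C:\mathsf{Nat}$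 in PCF (with any typing derivation) and let $C_f = \mathsf{let}\,a=[\![C]\!]\,\mathsf{in}\,a\,()$. Then: 1. $\vdash_E C_f:\mathsf{Unit}$ in HEPCF, with $E=\{\sigma:\mathsf{Unit}\rightsquigarrow 1\}$. 2. Every normal form of $C$ is of the form $\mathsf{return}(\mathsf{succ}^n(0))$ for some $n\in\mathbb N$, and then $ET(C_f)=t_n$, where $t_0=\mathsf{return}(())$ and $t_{n+1}=\sigma((),t_n)$ (ignoring the parameter leaves $()$, this is the unary tree $\sigma^n(\mathsf{return}(()))$). 3. If $C$ has no normal form, then $C_f$ has no normal form and $ET(C_f)=\bot$. -/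

import Mathlib

/-! ## PCF (fine-grained call-by-value)

Terms are in de Bruijn notation: variable `i` refers to the `i`-th enclosing binder. -/

namespace PCF

/-- Types: `Nat` and function types. -/
inductive Ty : Type
  | nat : Ty
  | arrow : Ty → Ty → Ty

mutual
/-- Values `0 | succ(V) | x | λx. C | fix f. V`. -/
inductive Val : Type
  | zero : Val
  | succ : Val → Val
  | var : ℕ → Val
  | lam : Comp → Val
  | fix : Val → Val
/-- Computations `V W | return(V) | let x = C in D | case(V; 0 ↦ C; succ(x) ↦ D)`.
The second argument of `letC` and the last argument of `case` bind one variable. -/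
inductive Comp : Type
  | app : Val → Val → Comp
  | ret : Val → Comp
  | letC : Comp → Comp → Comp
  | case : Val → Comp → Comp → Comp
end

/-- Extension of a renaming under one binder. -/
def liftRen (r : ℕ → ℕ) : ℕ → ℕ
  | 0 => 0
  | i + 1 => r i + 1

mutual
/-- Renaming of the free variables of a value. -/
def Val.rename (r : ℕ → ℕ) : Val → Val
  | .zero => .zero
  | .succ V => .succ (V.rename r)
  | .var i => .var (r i)
  | .lam C => .lam (C.rename (liftRen r))
  | .fix V => .fix (V.rename (liftRen r))
/-- Renaming of the free variables of a computation. -/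
def Comp.rename (r : ℕ → ℕ) : Comp → Comp
  | .app V W => .app (V.rename r) (W.rename r)
  | .ret V => .ret (V.rename r)
  | .letC C D => .letC (C.rename r) (D.rename (liftRen r))
  | .case V C D => .case (V.rename r) (C.rename r) (D.rename (liftRen r))
end

/-- Extension of a simultaneous substitution under one binder. -/
def liftSub (s : ℕ → Val) : ℕ → Val
  | 0 => .var 0
  | i + 1 => (s i).rename Nat.succ

mutual
/-- Capture-avoiding simultaneous substitution in a value. -/
def Val.subst (s : ℕ → Val) : Val → Val
  | .zero => .zero
  | .succ V => .succ (V.subst s)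
  | .var i => s i
  | .lam C => .lam (C.subst (liftSub s))
  | .fix V => .fix (V.subst (liftSub s))
/-- Capture-avoiding simultaneous substitution in a computation. -/
def Comp.subst (s : ℕ → Val) : Comp → Comp
  | .app V W => .app (V.subst s) (W.subst s)
  | .ret V => .ret (V.subst s)
  | .letC C D => .letC (C.subst s) (D.subst (liftSub s))
  | .case V C D => .case (V.subst s) (C.subst s) (D.subst (liftSub s))
end

/-- The substitution that replaces variable `0` by `W` and lowers all other variables. -/
def single (W : Val) : ℕ → Val
  | 0 => W
  | i + 1 => .var i

mutual
/-- Typing derivations `Γ ⊢ V : T`. They are data, because the translation below is defined by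
recursion on them. -/
inductive ValTy : List Ty → Val → Ty → Type
  | zero {Γ : List Ty} : ValTy Γ .zero .nat
  | succ {Γ : List Ty} {V : Val} : ValTy Γ V .nat → ValTy Γ (.succ V) .nat
  | var {Γ : List Ty} {i : ℕ} {T : Ty} : Γ[i]? = some T → ValTy Γ (.var i) T
  | lam {Γ : List Ty} {C : Comp} {T U : Ty} :
      CompTy (T :: Γ) C U → ValTy Γ (.lam C) (.arrow T U)
  | fix {Γ : List Ty} {V : Val} {T U : Ty} :
      ValTy (.arrow T U :: Γ) V (.arrow T U) → ValTy Γ (.fix V) (.arrow T U)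
/-- Typing derivations `Γ ⊢ C : T`. -/
inductive CompTy : List Ty → Comp → Ty → Type
  | app {Γ : List Ty} {V W : Val} {T U : Ty} :
      ValTy Γ V (.arrow T U) → ValTy Γ W T → CompTy Γ (.app V W) U
  | ret {Γ : List Ty} {V : Val} {T : Ty} : ValTy Γ V T → CompTy Γ (.ret V) T
  | letC {Γ : List Ty} {C D : Comp} {T U : Ty} :
      CompTy Γ C T → CompTy (T :: Γ) D U → CompTy Γ (.letC C D) U
  | case {Γ : List Ty} {V : Val} {C D : Comp} {T : Ty} :
      ValTy Γ V .nat → CompTy Γ C T → CompTy (.nat :: Γ) D T → CompTy Γ (.case V C D) T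
end

/-- One-step reduction `C → D`. -/
inductive Step : Comp → Comp → Prop
  | beta (C : Comp) (W : Val) : Step (.app (.lam C) W) (C.subst (single W))
  | fix (V W : Val) : Step (.app (.fix V) W) (.app (V.subst (single (.fix V))) W)
  | caseZero (C D : Comp) : Step (.case .zero C D) C
  | caseSucc (V : Val) (C D : Comp) : Step (.case (.succ V) C D) (D.subst (single V))
  | letRet (V : Val) (D : Comp) : Step (.letC (.ret V) D) (D.subst (single V))
  | letStep {C C₁ : Comp} (D : Comp) : Step C C₁ → Step (.letC C D) (.letC C₁ D)

/-- `N` is a normal form of `C`: `C →* N` and `N` cannot be reduced. -/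
def IsNormalFormOf (N C : Comp) : Prop :=
  Relation.ReflTransGen Step C N ∧ ∀ D : Comp, ¬ Step N D

/-- The numeral `succⁿ(0)`. -/
def numeral : ℕ → Val
  | 0 => .zero
  | n + 1 => .succ (numeral n)

end PCF

/-! ## HEPCF: finite base types, algebraic effects and handlers -/

namespace HEPCF

/-- The parameters of the language: finite ground types with their constants, among them a type
`Unit` with the single constant `()`, and the symbols `σ : B ⇝ k` for algebraic operations. -/
structure Signature where
  /-- ground types -/
  Base : Type
  /-- constants -/
  Const : Type
  /-- the ground type of a constant -/
  constTy : Const → Base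
  /-- every ground type is finite -/
  finite_base : ∀ B : Base, Finite {c : Const // constTy c = B}
  /-- the ground type `Unit` -/
  unit : Base
  /-- the constant `()` -/
  star : Const
  star_ty : constTy star = unit
  star_unique : ∀ c : Const, constTy c = unit → c = star
  /-- operation symbols -/
  Op : Type
  /-- the type `B` of the parameter of an operation `σ : B ⇝ k` -/
  opParam : Op → Base
  /-- the arity `k` of an operation `σ : B ⇝ k` -/
  opArity : Op → ℕ

/-- Types `B | k | T →_E U`, where `E` is a finite set of operations. -/
inductive Ty (S : Signature) : Type
  | base : S.Base → Ty S
  | enum : ℕ → Ty S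
  | arrow : Ty S → Finset S.Op → Ty S → Ty S

mutual
/-- Values `v | n | x | λx. C | fix f. V`. -/
inductive Val (S : Signature) : Type
  | const : S.Const → Val S
  | num : ℕ → Val S
  | var : ℕ → Val S
  | lam : Comp S → Val S
  | fix : Val S → Val S
/-- Computations. `op σ V C` is `σ(V; x. C)`, where `C` binds one variable; `case V k C` is
`case(V; C 0, …, C (k-1))`; `handle R E H C` is `handle {return(x) ↦ R} ∪ {σ(x; r) ↦ H σ | σ ∈ E} C`,
where `R` binds one variable `x` and each `H σ` binds two, `r` (variable `0`) and `x`
(variable `1`). -/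
inductive Comp (S : Signature) : Type
  | app : Val S → Val S → Comp S
  | op : S.Op → Val S → Comp S → Comp S
  | ret : Val S → Comp S
  | letC : Comp S → Comp S → Comp S
  | handle : Comp S → (E : Finset S.Op) → ({σ : S.Op // σ ∈ E} → Comp S) → Comp S → Comp S
  | case : Val S → (k : ℕ) → (Fin k → Comp S) → Comp S
end

/-- Extension of a renaming under one binder. -/
def liftRen (r : ℕ → ℕ) : ℕ → ℕ
  | 0 => 0
  | i + 1 => r i + 1

mutual
/-- Renaming of the free variables of a value. -/
def Val.rename {S : Signature} (r : ℕ → ℕ) : Val S → Val S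
  | .const c => .const c
  | .num n => .num n
  | .var i => .var (r i)
  | .lam C => .lam (C.rename (liftRen r))
  | .fix V => .fix (V.rename (liftRen r))
/-- Renaming of the free variables of a computation. -/
def Comp.rename {S : Signature} (r : ℕ → ℕ) : Comp S → Comp S
  | .app V W => .app (V.rename r) (W.rename r)
  | .op σ V C => .op σ (V.rename r) (C.rename (liftRen r))
  | .ret V => .ret (V.rename r)
  | .letC C D => .letC (C.rename r) (D.rename (liftRen r))
  | .handle R E H C =>
      .handle (R.rename (liftRen r)) E (fun σ => (H σ).rename (liftRen (liftRen r))) (C.rename r)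
  | .case V k C => .case (V.rename r) k (fun i => (C i).rename r)
end

/-- Extension of a simultaneous substitution under one binder. -/
def liftSub {S : Signature} (s : ℕ → Val S) : ℕ → Val S
  | 0 => .var 0
  | i + 1 => (s i).rename Nat.succ

mutual
/-- Capture-avoiding simultaneous substitution in a value. -/
def Val.subst {S : Signature} (s : ℕ → Val S) : Val S → Val S
  | .const c => .const c
  | .num n => .num n
  | .var i => s i
  | .lam C => .lam (C.subst (liftSub s))
  | .fix V => .fix (V.subst (liftSub s))
/-- Capture-avoiding simultaneous substitution in a computation. -/
def Comp.subst {S : Signature} (s : ℕ → Val S) : Comp S → Comp S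
  | .app V W => .app (V.subst s) (W.subst s)
  | .op σ V C => .op σ (V.subst s) (C.subst (liftSub s))
  | .ret V => .ret (V.subst s)
  | .letC C D => .letC (C.subst s) (D.subst (liftSub s))
  | .handle R E H C =>
      .handle (R.subst (liftSub s)) E (fun σ => (H σ).subst (liftSub (liftSub s))) (C.subst s)
  | .case V k C => .case (V.subst s) k (fun i => (C i).subst s)
end

/-- The substitution that replaces variable `0` by `W` and lowers all other variables. -/
def single {S : Signature} (W : Val S) : ℕ → Val S
  | 0 => W
  | i + 1 => .var i

/-- The substitution that replaces variable `0` by `W₀`, variable `1` by `W₁` and lowers all other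
variables. -/
def pair {S : Signature} (W₀ W₁ : Val S) : ℕ → Val S
  | 0 => W₀
  | 1 => W₁
  | i + 2 => .var i

mutual
/-- The typing judgement `Γ ⊢ V : T` for values. -/
inductive ValTy {S : Signature} : List (Ty S) → Val S → Ty S → Prop
  | const {Γ : List (Ty S)} (c : S.Const) : ValTy Γ (.const c) (.base (S.constTy c))
  | num {Γ : List (Ty S)} {n k : ℕ} : n < k → ValTy Γ (.num n) (.enum k)
  | var {Γ : List (Ty S)} {i : ℕ} {T : Ty S} : Γ[i]? = some T → ValTy Γ (.var i) T
  | lam {Γ : List (Ty S)} {E : Finset S.Op} {C : Comp S} {T U : Ty S} :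
      CompTy (T :: Γ) E C U → ValTy Γ (.lam C) (.arrow T E U)
  | fix {Γ : List (Ty S)} {E : Finset S.Op} {V : Val S} {T U : Ty S} :
      ValTy (.arrow T E U :: Γ) V (.arrow T E U) → ValTy Γ (.fix V) (.arrow T E U)
/-- The typing judgement `Γ ⊢_E C : T` for computations, written `CompTy Γ E C T`. -/
inductive CompTy {S : Signature} : List (Ty S) → Finset S.Op → Comp S → Ty S → Prop
  | app {Γ : List (Ty S)} {E : Finset S.Op} {V W : Val S} {T U : Ty S} :
      ValTy Γ V (.arrow T E U) → ValTy Γ W T → CompTy Γ E (.app V W) U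
  | op {Γ : List (Ty S)} {E : Finset S.Op} {σ : S.Op} {V : Val S} {C : Comp S} {T : Ty S} :
      σ ∈ E → ValTy Γ V (.base (S.opParam σ)) → CompTy (.enum (S.opArity σ) :: Γ) E C T →
      CompTy Γ E (.op σ V C) T
  | ret {Γ : List (Ty S)} {E : Finset S.Op} {V : Val S} {T : Ty S} :
      ValTy Γ V T → CompTy Γ E (.ret V) T
  | letC {Γ : List (Ty S)} {E : Finset S.Op} {C D : Comp S} {T U : Ty S} :
      CompTy Γ E C U → CompTy (U :: Γ) E D T → CompTy Γ E (.letC C D) T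
  | handle {Γ : List (Ty S)} {E₁ E : Finset S.Op} {R : Comp S}
      {H : {σ : S.Op // σ ∈ E₁} → Comp S} {C : Comp S} {T U : Ty S} :
      CompTy (U :: Γ) E R T →
      (∀ σ : {σ : S.Op // σ ∈ E₁},
        CompTy (.arrow (.enum (S.opArity σ.1)) E T :: .base (S.opParam σ.1) :: Γ) E (H σ) T) →
      CompTy Γ E₁ C U → CompTy Γ E (.handle R E₁ H C) T
  | case {Γ : List (Ty S)} {E : Finset S.Op} {V : Val S} {k : ℕ} {C : Fin k → Comp S} {T : Ty S} :
      ValTy Γ V (.enum k) → (∀ i : Fin k, CompTy Γ E (C i) T) → CompTy Γ E (.case V k C) T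
end

/-- One-step reduction `C → D`. -/
inductive Step {S : Signature} : Comp S → Comp S → Prop
  | beta (C : Comp S) (W : Val S) : Step (.app (.lam C) W) (C.subst (single W))
  | fix (V W : Val S) : Step (.app (.fix V) W) (.app (V.subst (single (.fix V))) W)
  | case (k : ℕ) (C : Fin k → Comp S) (i : Fin k) : Step (.case (.num i) k C) (C i)
  | letRet (V : Val S) (D : Comp S) : Step (.letC (.ret V) D) (D.subst (single V))
  | letStep {C C₁ : Comp S} (D : Comp S) : Step C C₁ → Step (.letC C D) (.letC C₁ D)
  | letOp (σ : S.Op) (V : Val S) (C D : Comp S) :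
      Step (.letC (.op σ V C) D) (.op σ V (.letC C (D.rename (liftRen Nat.succ))))
  | handleStep (R : Comp S) (E : Finset S.Op) (H : {σ : S.Op // σ ∈ E} → Comp S)
      {C C₁ : Comp S} : Step C C₁ → Step (.handle R E H C) (.handle R E H C₁)
  | handleRet (R : Comp S) (E : Finset S.Op) (H : {σ : S.Op // σ ∈ E} → Comp S) (V : Val S) :
      Step (.handle R E H (.ret V)) (R.subst (single V))
  | handleOp (R : Comp S) (E : Finset S.Op) (H : {σ : S.Op // σ ∈ E} → Comp S)
      (σ : {σ : S.Op // σ ∈ E}) (V : Val S) (C : Comp S) :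
      Step (.handle R E H (.op σ.1 V C))
        ((H σ).subst (pair
          (.lam (.handle (R.rename (liftRen Nat.succ)) E
            (fun τ => (H τ).rename (liftRen (liftRen Nat.succ))) C)) V))

/-- Reduction in any finite number of steps, `C →* D`. -/
def Steps {S : Signature} : Comp S → Comp S → Prop := Relation.ReflTransGen Step

/-- `N` is a normal form of `C`: `C →* N` and `N` cannot be reduced. -/
def IsNormalFormOf {S : Signature} (N C : Comp S) : Prop :=
  Steps C N ∧ ∀ D : Comp S, ¬ Step N D

/-! ### Effect trees -/

/-- The constructors of effect trees: `⊥`, the leaves `return(V)`, the operations and the leaves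
`v` for constants (which occur as parameters of operations). -/
inductive Label (S : Signature) : Type
  | bot : Label S
  | ret : Val S → Label S
  | op : S.Op → Label S
  | const : S.Const → Label S

/-- The number of children: `k + 1` for an operation `σ : B ⇝ k` (the first child is the
parameter), none for the leaves. -/
def Label.arity {S : Signature} : Label S → ℕ
  | .op σ => S.opArity σ + 1
  | _ => 0

/-- The polynomial functor of the tree constructors. -/
def treeFunctor (S : Signature) : PFunctor.{0, 0} := ⟨Label S, fun l => Fin l.arity⟩

/-- Possibly infinite trees over these constructors (the final coalgebra). -/
def Tree (S : Signature) : Type := (treeFunctor S).M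

/-- The tree `⊥`. -/
def Tree.bot {S : Signature} : Tree S := PFunctor.M.mk (F := treeFunctor S) ⟨.bot, Fin.elim0⟩

/-- The leaf `return(V)`. -/
def Tree.ret {S : Signature} (V : Val S) : Tree S :=
  PFunctor.M.mk (F := treeFunctor S) ⟨.ret V, Fin.elim0⟩

/-- The leaf `v` for a constant `v`. -/
def Tree.const {S : Signature} (c : S.Const) : Tree S :=
  PFunctor.M.mk (F := treeFunctor S) ⟨.const c, Fin.elim0⟩

/-- The tree `σ(p, t 0, …, t (k-1))`. -/
def Tree.op {S : Signature} (σ : S.Op) (p : Tree S) (t : Fin (S.opArity σ) → Tree S) : Tree S :=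
  PFunctor.M.mk (F := treeFunctor S)
    ⟨.op σ, Fin.cons (α := fun _ : Fin (S.opArity σ + 1) => Tree S) p t⟩

open Classical in
/-- The root of the effect tree of a computation (or of a parameter), together with what its
subtrees are generated from. A closed typed computation either reaches `return(V)`, or reaches
`σ(v; x. C)`, or is reduced forever; the last case is the one that gives `⊥`. -/
noncomputable def unfold {S : Signature} :
    Comp S ⊕ S.Const → (treeFunctor S).Obj (Comp S ⊕ S.Const)
  | .inr c => ⟨.const c, Fin.elim0⟩
  | .inl C =>
    if h : ∃ V : Val S, Steps C (.ret V) then ⟨.ret h.choose, Fin.elim0⟩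
    else if h : ∃ q : S.Op × S.Const × Comp S, Steps C (.op q.1 (.const q.2.1) q.2.2) then
      ⟨.op h.choose.1,
        Fin.cons (α := fun _ : Fin (S.opArity h.choose.1 + 1) => Comp S ⊕ S.Const)
          (.inr h.choose.2.1)
          (fun i => .inl (h.choose.2.2.subst (single (.num i))))⟩
    else ⟨.bot, Fin.elim0⟩

/-- The effect tree `ET(C)`, defined corecursively: `return(V)` if `C →* return(V)`,
`σ(v, ET(D[0/x]), …, ET(D[k-1/x]))` if `C →* σ(v; x. D)`, and `⊥` if there is no normal form. -/
noncomputable def effectTree {S : Signature} (C : Comp S) : Tree S :=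
  PFunctor.M.corec (F := treeFunctor S) unfold (.inl C)

/-- The tree representation `σⁿ(return(()))` of the number `n`; the first child of each node is the
parameter `()`, and `σ` is meant to have one further child. -/
def numTree {S : Signature} (σ : S.Op) : ℕ → Tree S
  | 0 => .ret (.const S.star)
  | n + 1 => .op σ (.const S.star) (fun _ => numTree σ n)

/-! ### The translation from PCF -/

/-- The value `()`. -/
def unitVal (S : Signature) : Val S := .const S.star

/-- The zero of a type. It is used only for types all of whose ground types are `Unit`. -/
def zeroVal {S : Signature} : Ty S → Val S
  | .base _ => unitVal S
  | .enum _ => .num 0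
  | .arrow _ _ U => .lam (.ret (zeroVal U))

/-- `λ f, g. C`, that is `λ f. return(λ g. C)`. -/
def lam2 {S : Signature} (C : Comp S) : Val S := .lam (.ret (.lam C))

/-- `V W₁ W₂`, that is `let x = V W₁ in x W₂`. -/
def app2 {S : Signature} (V W₁ W₂ : Val S) : Comp S :=
  .letC (.app V W₁) (.app (.var 0) (W₂.rename Nat.succ))

/-- Translation of types: `⟦Nat⟧ = Unit →_E Unit` and `⟦T → U⟧ = ⟦T⟧ →_E ⟦U⟧`, for `E = {σ}`. -/
def transTy {S : Signature} (σ : S.Op) : PCF.Ty → Ty S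
  | .nat => .arrow (.base S.unit) {σ} (.base S.unit)
  | .arrow T U => .arrow (transTy σ T) {σ} (transTy σ U)

/-- The return clause of the handler `H(C, D)`, for `C` already translated:
`return(x) ↦ return(λ p. p Z_{Unit → Unit} (λ x. C))`. -/
def retClause {S : Signature} (σ : S.Op) (C : Comp S) : Comp S :=
  .ret (.lam (app2 (.var 0)
    (zeroVal (.arrow (.base S.unit) {σ} (.base S.unit)))
    (.lam (C.rename (fun i => i + 3)))))

/-- The operation clause of the handler `H(C, D)`, for `D` already translated and of type `T`:
`σ(r) ↦ let n = return(λ x. let y = r 0 (λ f, g. let z = f () in return(Z_T)) in return(()))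
in return(λ p. p (λ x. σ((); z. n ())) (λ x. D))`, where `n` is variable `0` of `D`. -/
def opClause {S : Signature} (σ : S.Op) (T : Ty S) (D : Comp S) : Comp S :=
  .letC
    (.ret (.lam (.letC
      (app2 (.var 1) (.num 0)
        (lam2 (.letC (.app (.var 1) (unitVal S)) (.ret (zeroVal T)))))
      (.ret (zeroVal (.base S.unit))))))
    (.ret (.lam (app2 (.var 0)
      (.lam (.op σ (unitVal S) (.app (.var 3) (unitVal S))))
      (.lam (D.rename (fun i => if i = 0 then 2 else i + 4))))))

mutual
/-- The translation `⟦V⟧` of a typed PCF value. -/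
def transVal {S : Signature} (σ : S.Op) :
    {Γ : List PCF.Ty} → {V : PCF.Val} → {T : PCF.Ty} → PCF.ValTy Γ V T → Val S
  | _, _, _, .zero => zeroVal (transTy σ .nat)
  | _, _, _, .succ d =>
      .lam (.op σ (unitVal S) (.app ((transVal σ d).rename (fun i => i + 2)) (unitVal S)))
  | _, _, _, .var (i := i) _ => .var i
  | _, _, _, .lam d => .lam (transComp σ d)
  | _, _, _, .fix d => .fix (transVal σ d)
/-- The translation `⟦C⟧` of a typed PCF computation; in particular
`⟦case(V; 0 ↦ C; succ(n) ↦ D)⟧ = let a = (handle H(C, D) (⟦V⟧ ())) in a (λ f, g. g ())`. -/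
def transComp {S : Signature} (σ : S.Op) :
    {Γ : List PCF.Ty} → {C : PCF.Comp} → {T : PCF.Ty} → PCF.CompTy Γ C T → Comp S
  | _, _, _, .app d e => .app (transVal σ d) (transVal σ e)
  | _, _, _, .ret d => .ret (transVal σ d)
  | _, _, _, .letC d e => .letC (transComp σ d) (transComp σ e)
  | _, _, _, .case (T := T) dV dC dD =>
      .letC
        (.handle (retClause σ (transComp σ dC)) {σ}
          (fun _ => opClause σ (transTy σ T) (transComp σ dD))
          (.app (transVal σ dV) (unitVal S)))
        (.app (.var 0) (lam2 (.app (.var 0) (unitVal S))))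
end

/-- The computation `C_f`, that is `let a = ⟦C⟧ in a ()`. -/
def finalComp {S : Signature} (σ : S.Op) {C : PCF.Comp} (d : PCF.CompTy [] C .nat) : Comp S :=
  .letC (transComp σ d) (.app (.var 0) (unitVal S))

end HEPCF

/-!
PCF computations are related to HEPCF computations by a simulation that contains the translation.
PCF reduction steps of closed computations are matched by one or more HEPCF steps
(`HEPCF.SimComp.step`), a PCF value `return(V)` is matched by `return(W)` with `W` simulating `V`,
and closed well-typed PCF computations never get stuck (`HEPCF.SimComp.progress`). As HEPCF
reduction is deterministic (`HEPCF.Step.deterministic`), termination and divergence carry over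
from `C` to its translation (`HEPCF.SimComp.diverges`).

The graph of the translation alone is not a simulation: the value to which the translated `case`
binds the predecessor `n` is a function that runs the handled computation again, and this is not
the translation of any PCF numeral. All that later evaluation can observe of it, however, is that
its application to `()` performs `σ(())` a certain number of times and returns `()`. Hence the
simulation relation (`HEPCF.SimVal`, `HEPCF.SimComp`) consists of the clauses of the translation
together with one more: the numeral `succⁿ(0)` is simulated by every closed `W` for which `W ()`
counts to `n` in this sense (`HEPCF.Counts`, `HEPCF.Represents`). The relation carries the PCF
types and is stable under substitution, so subject reduction need not be treated separately.

The heart of the proof is the case distinction. If `X` counts to `0`, then `handle H(C, D) X`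
evaluates to `λ p. p Z (λ x. C)`; if it counts to `m + 1`, then to `λ p. p (λ x. σ((); z. N ()))
(λ x. D[N/n])`, where `N` represents `m` (`HEPCF.handleCase_counts`). This is an induction on the
number: `N` handles the rest of `X` again and runs the first component of the resulting pair,
which for `m = k + 1` performs `σ` once and calls the value that represents `k`.

At type `Nat` the simulating value represents a number `n`, so that `C_f` counts to `n`; its
effect tree is then read off (`HEPCF.Counts.effectTree_eq`).
-/

namespace HEPCF

/-! ### Substitution in HEPCF -/

theorem liftSub_var_comp {S : Signature} (r : ℕ → ℕ) :
    liftSub (S := S) (fun i => .var (r i)) = fun i => .var (liftRen r i) := by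
  funext i; cases i <;> rfl

theorem liftSub_comp_liftRen {S : Signature} (s : ℕ → Val S) (r : ℕ → ℕ) :
    (fun i => liftSub s (liftRen r i)) = liftSub fun i => s (r i) := by
  funext i; cases i <;> rfl

theorem liftSub_var {S : Signature} : liftSub (S := S) .var = .var := by
  funext i; cases i <;> rfl

mutual
theorem Val.rename_eq_subst {S : Signature} (r : ℕ → ℕ) :
    ∀ V : Val S, V.rename r = V.subst fun i => .var (r i)
  | .const _ | .num _ | .var _ => rfl
  | .lam C => by simp [Val.rename, Val.subst, C.rename_eq_subst, liftSub_var_comp]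
  | .fix V => by simp [Val.rename, Val.subst, V.rename_eq_subst, liftSub_var_comp]
theorem Comp.rename_eq_subst {S : Signature} (r : ℕ → ℕ) :
    ∀ C : Comp S, C.rename r = C.subst fun i => .var (r i)
  | .app V W => by simp [Comp.rename, Comp.subst, V.rename_eq_subst, W.rename_eq_subst]
  | .op _ V C => by
    simp [Comp.rename, Comp.subst, V.rename_eq_subst, C.rename_eq_subst, liftSub_var_comp]
  | .ret V => by simp [Comp.rename, Comp.subst, V.rename_eq_subst]
  | .letC C D => by
    simp [Comp.rename, Comp.subst, C.rename_eq_subst, D.rename_eq_subst, liftSub_var_comp]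
  | .handle R _ H C => by
    simp [Comp.rename, Comp.subst, C.rename_eq_subst, R.rename_eq_subst,
      fun σ => (H σ).rename_eq_subst, liftSub_var_comp]
  | .case V _ C => by
    simp [Comp.rename, Comp.subst, V.rename_eq_subst, fun i => (C i).rename_eq_subst]
end

mutual
theorem Val.subst_rename {S : Signature} (r : ℕ → ℕ) (s : ℕ → Val S) :
    ∀ V : Val S, (V.rename r).subst s = V.subst fun i => s (r i)
  | .const _ | .num _ | .var _ => rfl
  | .lam C => by simp [Val.rename, Val.subst, C.subst_rename, liftSub_comp_liftRen]
  | .fix V => by simp [Val.rename, Val.subst, V.subst_rename, liftSub_comp_liftRen]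
theorem Comp.subst_rename {S : Signature} (r : ℕ → ℕ) (s : ℕ → Val S) :
    ∀ C : Comp S, (C.rename r).subst s = C.subst fun i => s (r i)
  | .app V W => by simp [Comp.rename, Comp.subst, V.subst_rename, W.subst_rename]
  | .op _ V C => by
    simp [Comp.rename, Comp.subst, V.subst_rename, C.subst_rename, liftSub_comp_liftRen]
  | .ret V => by simp [Comp.rename, Comp.subst, V.subst_rename]
  | .letC C D => by
    simp [Comp.rename, Comp.subst, C.subst_rename, D.subst_rename, liftSub_comp_liftRen]
  | .handle R _ H C => by
    simp [Comp.rename, Comp.subst, C.subst_rename, R.subst_rename,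
      fun σ => (H σ).subst_rename, liftSub_comp_liftRen]
  | .case V _ C => by
    simp [Comp.rename, Comp.subst, V.subst_rename, fun i => (C i).subst_rename]
end

theorem Val.rename_rename {S : Signature} (r r' : ℕ → ℕ) (V : Val S) :
    (V.rename r).rename r' = V.rename fun i => r' (r i) := by
  rw [Val.rename_eq_subst r', Val.subst_rename, ← Val.rename_eq_subst]

theorem rename_liftSub {S : Signature} (s : ℕ → Val S) (r : ℕ → ℕ) :
    (fun i => (liftSub s i).rename (liftRen r)) = liftSub fun i => (s i).rename r := by
  funext i
  cases i with
  | zero => rfl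
  | succ i => simp only [liftSub, Val.rename_rename]; rfl

mutual
theorem Val.rename_subst {S : Signature} (s : ℕ → Val S) (r : ℕ → ℕ) :
    ∀ V : Val S, (V.subst s).rename r = V.subst fun i => (s i).rename r
  | .const _ | .num _ | .var _ => rfl
  | .lam C => by simp [Val.rename, Val.subst, C.rename_subst, rename_liftSub]
  | .fix V => by simp [Val.rename, Val.subst, V.rename_subst, rename_liftSub]
theorem Comp.rename_subst {S : Signature} (s : ℕ → Val S) (r : ℕ → ℕ) :
    ∀ C : Comp S, (C.subst s).rename r = C.subst fun i => (s i).rename r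
  | .app V W => by simp [Comp.rename, Comp.subst, V.rename_subst, W.rename_subst]
  | .op _ V C => by
    simp [Comp.rename, Comp.subst, V.rename_subst, C.rename_subst, rename_liftSub]
  | .ret V => by simp [Comp.rename, Comp.subst, V.rename_subst]
  | .letC C D => by
    simp [Comp.rename, Comp.subst, C.rename_subst, D.rename_subst, rename_liftSub]
  | .handle R _ H C => by
    simp [Comp.rename, Comp.subst, C.rename_subst, R.rename_subst,
      fun σ => (H σ).rename_subst, rename_liftSub]
  | .case V _ C => by
    simp [Comp.rename, Comp.subst, V.rename_subst, fun i => (C i).rename_subst]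
end

theorem subst_liftSub {S : Signature} (s t : ℕ → Val S) :
    (fun i => (liftSub s i).subst (liftSub t)) = liftSub fun i => (s i).subst t := by
  funext i
  cases i with
  | zero => rfl
  | succ i => simp only [liftSub, Val.subst_rename, Val.rename_subst]

mutual
theorem Val.subst_subst {S : Signature} (s t : ℕ → Val S) :
    ∀ V : Val S, (V.subst s).subst t = V.subst fun i => (s i).subst t
  | .const _ | .num _ | .var _ => rfl
  | .lam C => by simp [Val.subst, C.subst_subst, HEPCF.subst_liftSub]
  | .fix V => by simp [Val.subst, V.subst_subst, HEPCF.subst_liftSub]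
theorem Comp.subst_subst {S : Signature} (s t : ℕ → Val S) :
    ∀ C : Comp S, (C.subst s).subst t = C.subst fun i => (s i).subst t
  | .app V W => by simp [Comp.subst, V.subst_subst, W.subst_subst]
  | .op _ V C => by
    simp [Comp.subst, V.subst_subst, C.subst_subst, HEPCF.subst_liftSub]
  | .ret V => by simp [Comp.subst, V.subst_subst]
  | .letC C D => by
    simp [Comp.subst, C.subst_subst, D.subst_subst, HEPCF.subst_liftSub]
  | .handle R _ H C => by
    simp [Comp.subst, C.subst_subst, R.subst_subst,
      fun σ => (H σ).subst_subst, HEPCF.subst_liftSub]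
  | .case V _ C => by
    simp [Comp.subst, V.subst_subst, fun i => (C i).subst_subst]
end

mutual
theorem Val.subst_var {S : Signature} : ∀ V : Val S, V.subst .var = V
  | .const _ | .num _ | .var _ => rfl
  | .lam C => by simp [Val.subst, liftSub_var, C.subst_var]
  | .fix V => by simp [Val.subst, liftSub_var, V.subst_var]
theorem Comp.subst_var {S : Signature} : ∀ C : Comp S, C.subst .var = C
  | .app V W => by simp [Comp.subst, V.subst_var, W.subst_var]
  | .op _ V C => by simp [Comp.subst, liftSub_var, V.subst_var, C.subst_var]
  | .ret V => by simp [Comp.subst, V.subst_var]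
  | .letC C D => by simp [Comp.subst, liftSub_var, C.subst_var, D.subst_var]
  | .handle R _ H C => by
    simp [Comp.subst, liftSub_var, C.subst_var, R.subst_var, fun σ => (H σ).subst_var]
  | .case V _ C => by simp [Comp.subst, V.subst_var, fun i => (C i).subst_var]
end

/-! ### Scoped terms -/

/-- All free variables of the value `V` are below `k`. This is expressed by the property for which
it is used: the result of a substitution depends only on the values at the first `k` variables. -/
def Val.Scoped {S : Signature} (k : ℕ) (V : Val S) : Prop :=
  ∀ s t : ℕ → Val S, (∀ i < k, s i = t i) → V.subst s = V.subst t

/-- All free variables of the computation `C` are below `k`, in the sense of `Val.Scoped`. -/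
def Comp.Scoped {S : Signature} (k : ℕ) (C : Comp S) : Prop :=
  ∀ s t : ℕ → Val S, (∀ i < k, s i = t i) → C.subst s = C.subst t

theorem liftSub_agree {S : Signature} {k : ℕ} {s t : ℕ → Val S} (h : ∀ i < k, s i = t i) :
    ∀ i < k + 1, liftSub s i = liftSub t i := by
  intro i hi
  cases i with
  | zero => rfl
  | succ i => simp only [liftSub, h i (by omega)]

theorem Val.Scoped.subst_eq {S : Signature} {V : Val S} (h : V.Scoped 0) (s : ℕ → Val S) :
    V.subst s = V := by
  rw [h s .var (by simp), V.subst_var]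

theorem Val.Scoped.rename_eq {S : Signature} {V : Val S} (h : V.Scoped 0) (r : ℕ → ℕ) :
    V.rename r = V := by
  rw [V.rename_eq_subst, h.subst_eq]

theorem Comp.Scoped.subst_eq {S : Signature} {C : Comp S} (h : C.Scoped 0) (s : ℕ → Val S) :
    C.subst s = C := by
  rw [h s .var (by simp), C.subst_var]

theorem Comp.Scoped.rename_eq {S : Signature} {C : Comp S} (h : C.Scoped 0) (r : ℕ → ℕ) :
    C.rename r = C := by
  rw [C.rename_eq_subst, h.subst_eq]

theorem Comp.Scoped.subst_liftSub {S : Signature} {C : Comp S} (h : C.Scoped 1) (s : ℕ → Val S) :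
    C.subst (liftSub s) = C := by
  rw [h _ .var (by simp [liftSub]), C.subst_var]

theorem Comp.Scoped.rename {S : Signature} {k l : ℕ} {C : Comp S} {r : ℕ → ℕ} (h : C.Scoped k)
    (hr : ∀ i < k, r i < l) : (C.rename r).Scoped l := by
  intro s t hst
  rw [Comp.subst_rename, Comp.subst_rename]
  exact h _ _ fun i hi => hst _ (hr i hi)

theorem Val.Scoped.rename {S : Signature} {k l : ℕ} {V : Val S} {r : ℕ → ℕ} (h : V.Scoped k)
    (hr : ∀ i < k, r i < l) : (V.rename r).Scoped l := by
  intro s t hst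
  rw [Val.subst_rename, Val.subst_rename]
  exact h _ _ fun i hi => hst _ (hr i hi)

theorem Val.Scoped.of_closed {S : Signature} {V : Val S} (h : V.Scoped 0) (k : ℕ) : V.Scoped k :=
  fun s t _ => h s t (by simp)

theorem Val.scoped_num {S : Signature} (k n : ℕ) : (Val.num n : Val S).Scoped k :=
  fun _ _ _ => rfl

theorem scoped_unitVal {S : Signature} (k : ℕ) : (unitVal S).Scoped k :=
  fun _ _ _ => rfl

theorem Val.scoped_var {S : Signature} {k i : ℕ} (h : i < k) : (Val.var i : Val S).Scoped k :=
  fun _ _ hst => hst i h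

theorem Val.Scoped.lam {S : Signature} {k : ℕ} {C : Comp S} (h : C.Scoped (k + 1)) :
    (Val.lam C).Scoped k :=
  fun s t hst => by simp only [Val.subst, h _ _ (liftSub_agree hst)]

theorem Val.Scoped.fix {S : Signature} {k : ℕ} {V : Val S} (h : V.Scoped (k + 1)) :
    (Val.fix V).Scoped k :=
  fun s t hst => by simp only [Val.subst, h _ _ (liftSub_agree hst)]

theorem Comp.Scoped.app {S : Signature} {k : ℕ} {V W : Val S} (hV : V.Scoped k)
    (hW : W.Scoped k) : (Comp.app V W).Scoped k :=
  fun s t hst => by simp only [Comp.subst, hV s t hst, hW s t hst]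

theorem Comp.Scoped.ret {S : Signature} {k : ℕ} {V : Val S} (hV : V.Scoped k) :
    (Comp.ret V).Scoped k :=
  fun s t hst => by simp only [Comp.subst, hV s t hst]

theorem Comp.Scoped.op {S : Signature} {k : ℕ} {σ : S.Op} {V : Val S} {C : Comp S}
    (hV : V.Scoped k) (hC : C.Scoped (k + 1)) : (Comp.op σ V C).Scoped k :=
  fun s t hst => by simp only [Comp.subst, hV s t hst, hC _ _ (liftSub_agree hst)]

theorem Comp.Scoped.letC {S : Signature} {k : ℕ} {C D : Comp S} (hC : C.Scoped k)
    (hD : D.Scoped (k + 1)) : (Comp.letC C D).Scoped k :=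
  fun s t hst => by simp only [Comp.subst, hC s t hst, hD _ _ (liftSub_agree hst)]

theorem Comp.Scoped.handle {S : Signature} {k : ℕ} {R : Comp S} {E : Finset S.Op}
    {H : {σ : S.Op // σ ∈ E} → Comp S} {C : Comp S} (hR : R.Scoped (k + 1))
    (hH : ∀ σ, (H σ).Scoped (k + 2)) (hC : C.Scoped k) : (Comp.handle R E H C).Scoped k :=
  fun s t hst => by
    simp only [Comp.subst, hR _ _ (liftSub_agree hst), hC s t hst,
      fun σ => hH σ _ _ (liftSub_agree (liftSub_agree hst))]

theorem scoped_zeroVal {S : Signature} : ∀ (T : Ty S) (k : ℕ), (zeroVal T).Scoped k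
  | .base _, k => scoped_unitVal k
  | .enum _, k => Val.scoped_num k 0
  | .arrow _ _ U, k => .lam (.ret (scoped_zeroVal U (k + 1)))

theorem Comp.Scoped.app2 {S : Signature} {k : ℕ} {V W₁ W₂ : Val S} (hV : V.Scoped k)
    (hW₁ : W₁.Scoped k) (hW₂ : W₂.Scoped k) : (HEPCF.app2 V W₁ W₂).Scoped k :=
  .letC (.app hV hW₁) (.app (Val.scoped_var (by omega)) (hW₂.rename (by simp)))

theorem Comp.Scoped.retClause {S : Signature} {k : ℕ} {C : Comp S} (σ : S.Op) (h : C.Scoped k) :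
    (HEPCF.retClause σ C).Scoped (k + 1) :=
  .ret (.lam (.app2 (Val.scoped_var (by omega)) (scoped_zeroVal _ _)
    (.lam (h.rename fun i hi => by omega))))

theorem Comp.Scoped.opClause {S : Signature} {k : ℕ} {D : Comp S} (σ : S.Op) (T : Ty S)
    (h : D.Scoped (k + 1)) : (HEPCF.opClause σ T D).Scoped (k + 2) := by
  refine .letC (.ret (.lam (.letC (.app2 (Val.scoped_var (by omega)) (Val.scoped_num _ _)
    (.lam (.ret (.lam (.letC (.app (Val.scoped_var (by omega)) (scoped_unitVal _))
      (.ret (scoped_zeroVal _ _))))))) (.ret (scoped_zeroVal _ _)))))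
    (.ret (.lam (.app2 (Val.scoped_var (by omega))
      (.lam (.op (scoped_unitVal _) (.app (Val.scoped_var (by omega)) (scoped_unitVal _))))
      (.lam (h.rename fun i hi => ?_)))))
  split <;> omega

theorem zeroVal_subst {S : Signature} (T : Ty S) (s : ℕ → Val S) :
    (zeroVal T).subst s = zeroVal T :=
  (scoped_zeroVal T 0).subst_eq s

theorem unitVal_subst {S : Signature} (s : ℕ → Val S) : (unitVal S).subst s = unitVal S := rfl

theorem retClause_subst {S : Signature} (σ : S.Op) (C : Comp S) (s : ℕ → Val S) :
    (retClause σ C).subst (liftSub s) = retClause σ (C.subst s) := by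
  simp [retClause, app2, Comp.subst, Val.subst, Val.rename, liftSub,
    Comp.subst_rename, zeroVal_subst, Comp.rename_subst, liftRen, Val.rename_rename]

theorem opClause_subst {S : Signature} (σ : S.Op) (T : Ty S) (D : Comp S) (s : ℕ → Val S) :
    (opClause σ T D).subst (liftSub (liftSub s)) = opClause σ T (D.subst (liftSub s)) := by
  simp [opClause, lam2, app2, Comp.subst, Val.subst, Val.rename, Comp.rename, liftSub,
    Comp.subst_rename, zeroVal_subst, (scoped_zeroVal _ 0).rename_eq, Comp.rename_subst,
    liftRen, unitVal_subst, (scoped_unitVal 0).rename_eq]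
  congr 1
  funext i
  cases i with
  | zero => rfl
  | succ i => simp [Val.rename_rename, liftRen]

/-! ### Reduction in HEPCF -/

theorem not_step_ret {S : Signature} (V : Val S) (D : Comp S) : ¬ Step (.ret V) D := nofun

theorem not_step_op {S : Signature} (σ : S.Op) (V : Val S) (C D : Comp S) :
    ¬ Step (.op σ V C) D := nofun

theorem Step.deterministic {S : Signature} {C D D' : Comp S} (h : Step C D) (h' : Step C D') :
    D = D' := by
  induction h generalizing D' with
  | beta | fix => cases h'; rfl
  | case k C i =>
    generalize hM : Comp.case (.num i) k C = M at h'
    cases h' with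
    | case k' C' i' =>
      simp only [Comp.case.injEq, Val.num.injEq] at hM
      obtain ⟨hi, rfl, hC⟩ := hM
      obtain rfl := eq_of_heq hC
      obtain rfl := Fin.ext hi
      rfl
    | _ => cases hM
  | letRet =>
    cases h' with
    | letRet => rfl
    | letStep _ h => exact absurd h (not_step_ret _ _)
  | letStep D h ih =>
    cases h' with
    | letStep _ h => rw [ih h]
    | letRet => exact absurd h (not_step_ret _ _)
    | letOp => exact absurd h (not_step_op _ _ _ _)
  | letOp =>
    cases h' with
    | letOp => rfl
    | letStep _ h => exact absurd h (not_step_op _ _ _ _)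
  | handleStep R E H h ih =>
    cases h' with
    | handleStep _ _ _ h => rw [ih h]
    | handleRet => exact absurd h (not_step_ret _ _)
    | handleOp => exact absurd h (not_step_op _ _ _ _)
  | handleRet =>
    cases h' with
    | handleRet => rfl
    | handleStep _ _ _ h => exact absurd h (not_step_ret _ _)
  | handleOp R E H τ V C =>
    generalize hM : Comp.handle R E H (.op τ.1 V C) = M at h'
    cases h' with
    | handleOp R' E' H' τ' V' C' =>
      simp only [Comp.handle.injEq, Comp.op.injEq] at hM
      obtain ⟨rfl, rfl, hH, hτ, rfl, rfl⟩ := hM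
      obtain rfl := eq_of_heq hH
      obtain rfl := Subtype.ext hτ
      rfl
    | handleStep _ _ _ h =>
      simp only [Comp.handle.injEq] at hM
      obtain ⟨-, -, -, rfl⟩ := hM
      exact absurd h (not_step_op _ _ _ _)
    | _ => cases hM

theorem Steps.letC {S : Signature} {C C' : Comp S} (D : Comp S) (h : Steps C C') :
    Steps (.letC C D) (.letC C' D) :=
  Relation.ReflTransGen.lift (fun C => Comp.letC C D) (fun _ _ h => Step.letStep D h) _ _ h

theorem Steps.handle {S : Signature} (R : Comp S) (E : Finset S.Op)
    (H : {σ : S.Op // σ ∈ E} → Comp S) {C C' : Comp S} (h : Steps C C') :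
    Steps (.handle R E H C) (.handle R E H C') :=
  Relation.ReflTransGen.lift (fun C => Comp.handle R E H C) (fun _ _ h => Step.handleStep R E H h)
    _ _ h

/-- By determinism, every normal form of `C` is a normal form of every reduct of `C`. -/
theorem Steps.of_normal {S : Signature} {C D N : Comp S} (hN : ∀ D, ¬ Step N D) (h : Steps C N)
    (h' : Steps C D) : Steps D N := by
  induction h' using Relation.ReflTransGen.head_induction_on with
  | refl => exact h
  | head hs _ ih =>
    apply ih
    rcases Relation.ReflTransGen.cases_head h with rfl | ⟨C', h₁, h₂⟩
    · exact absurd hs (hN _)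
    · rwa [hs.deterministic h₁]

theorem Steps.normal_unique {S : Signature} {C N N' : Comp S} (hN : ∀ D, ¬ Step N D)
    (hN' : ∀ D, ¬ Step N' D) (h : Steps C N) (h' : Steps C N') : N' = N := by
  rcases Relation.ReflTransGen.cases_head (Steps.of_normal hN h h') with rfl | ⟨C', h₁, _⟩
  · rfl
  · exact absurd h₁ (hN' _)

/-! ### Computations and values that represent a number -/

/-- The computation `C` counts to `n`: it performs `σ(())` exactly `n` times and returns `()`.
The continuations are required to have no further free variables, so that substitutions leave them
unchanged. -/
def Counts {S : Signature} (σ : S.Op) : ℕ → Comp S → Prop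
  | 0, C => Steps C (.ret (unitVal S))
  | n + 1, C => ∃ K : Comp S, Steps C (.op σ (unitVal S) K) ∧ K.Scoped 1 ∧
      Counts σ n (K.subst (single (.num 0)))

theorem Counts.of_steps {S : Signature} {σ : S.Op} {n : ℕ} {C D : Comp S} (h : Steps C D)
    (hD : Counts σ n D) : Counts σ n C := by
  cases n with
  | zero => exact h.trans hD
  | succ n =>
    obtain ⟨K, hK, hn⟩ := hD
    exact ⟨K, h.trans hK, hn⟩

/-- The closed value `W` represents the number `n` if `W ()` counts to `n`. -/
structure Represents {S : Signature} (σ : S.Op) (n : ℕ) (W : Val S) : Prop where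
  closed : W.Scoped 0
  counts : Counts σ n (.app W (unitVal S))

/-! ### The simulation relation -/

mutual
/-- `SimVal σ Γ V T W`: the HEPCF value `W` simulates the PCF value `V`, which has type `T` in `Γ`.
The clauses follow the translation, except that the type at which the default value in a handler is
taken is arbitrary, and that a numeral is simulated by every closed value that represents it. -/
inductive SimVal {S : Signature} (σ : S.Op) : List PCF.Ty → PCF.Val → PCF.Ty → Val S → Prop
  | zero {Γ} : SimVal σ Γ .zero .nat (zeroVal (transTy σ .nat))
  | succ {Γ V W} : SimVal σ Γ V .nat W → SimVal σ Γ (.succ V) .nat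
      (.lam (.op σ (unitVal S) (.app (W.rename (fun i => i + 2)) (unitVal S))))
  | var {Γ i T} : Γ[i]? = some T → SimVal σ Γ (.var i) T (.var i)
  | lam {Γ C T U M} : SimComp σ (T :: Γ) C U M → SimVal σ Γ (.lam C) (.arrow T U) (.lam M)
  | fix {Γ V T U W} : SimVal σ (.arrow T U :: Γ) V (.arrow T U) W →
      SimVal σ Γ (.fix V) (.arrow T U) (.fix W)
  | numeral {Γ V n W} : V = PCF.numeral n → Represents σ n W → SimVal σ Γ V .nat W
/-- `SimComp σ Γ C T M`: the HEPCF computation `M` simulates the PCF computation `C`, which has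
type `T` in `Γ`. -/
inductive SimComp {S : Signature} (σ : S.Op) : List PCF.Ty → PCF.Comp → PCF.Ty → Comp S → Prop
  | app {Γ V V' T U W W'} : SimVal σ Γ V (.arrow T U) W → SimVal σ Γ V' T W' →
      SimComp σ Γ (.app V V') U (.app W W')
  | ret {Γ V T W} : SimVal σ Γ V T W → SimComp σ Γ (.ret V) T (.ret W)
  | letC {Γ C D T U M N} : SimComp σ Γ C T M → SimComp σ (T :: Γ) D U N →
      SimComp σ Γ (.letC C D) U (.letC M N)
  | case {Γ V C D T W M N} (T' : Ty S) : SimVal σ Γ V .nat W → SimComp σ Γ C T M →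
      SimComp σ (.nat :: Γ) D T N → SimComp σ Γ (.case V C D) T
        (.letC (.handle (retClause σ M) {σ} (fun _ => opClause σ T' N) (.app W (unitVal S)))
          (.app (.var 0) (lam2 (.app (.var 0) (unitVal S)))))
end

mutual
theorem simVal_trans {S : Signature} (σ : S.Op) : {Γ : List PCF.Ty} → {V : PCF.Val} →
    {T : PCF.Ty} → (d : PCF.ValTy Γ V T) → SimVal σ Γ V T (transVal σ d)
  | _, _, _, .zero => .zero
  | _, _, _, .succ d => .succ (simVal_trans σ d)
  | _, _, _, .var h => .var h
  | _, _, _, .lam d => .lam (simComp_trans σ d)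
  | _, _, _, .fix d => .fix (simVal_trans σ d)
theorem simComp_trans {S : Signature} (σ : S.Op) : {Γ : List PCF.Ty} → {C : PCF.Comp} →
    {T : PCF.Ty} → (d : PCF.CompTy Γ C T) → SimComp σ Γ C T (transComp σ d)
  | _, _, _, .app d e => .app (simVal_trans σ d) (simVal_trans σ e)
  | _, _, _, .ret d => .ret (simVal_trans σ d)
  | _, _, _, .letC d e => .letC (simComp_trans σ d) (simComp_trans σ e)
  | _, _, _, .case dV dC dD =>
    .case _ (simVal_trans σ dV) (simComp_trans σ dC) (simComp_trans σ dD)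
end

mutual
theorem SimVal.scoped {S : Signature} {σ : S.Op} : {Γ : List PCF.Ty} → {V : PCF.Val} →
    {T : PCF.Ty} → {W : Val S} → SimVal σ Γ V T W → W.Scoped Γ.length
  | _, _, _, _, .zero => scoped_zeroVal _ _
  | _, _, _, _, .succ h => .lam (.op (scoped_unitVal _)
      (.app (h.scoped.rename (by simp)) (scoped_unitVal _)))
  | _, _, _, _, .var h => Val.scoped_var (List.getElem?_eq_some_iff.1 h).1
  | _, _, _, _, .lam h => .lam h.scoped
  | _, _, _, _, .fix h => .fix h.scoped
  | _, _, _, _, .numeral _ h => h.closed.of_closed _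
theorem SimComp.scoped {S : Signature} {σ : S.Op} : {Γ : List PCF.Ty} → {C : PCF.Comp} →
    {T : PCF.Ty} → {M : Comp S} → SimComp σ Γ C T M → M.Scoped Γ.length
  | _, _, _, _, .app h h' => .app h.scoped h'.scoped
  | _, _, _, _, .ret h => .ret h.scoped
  | _, _, _, _, .letC h h' => .letC h.scoped h'.scoped
  | _, _, _, _, .case T' hV hC hD =>
    .letC (.handle (.retClause σ hC.scoped) (fun _ => .opClause σ T' hD.scoped)
      (.app hV.scoped (scoped_unitVal _)))
      (.app (Val.scoped_var (by omega)) (.lam (.ret (.lam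
        (.app (Val.scoped_var (by omega)) (scoped_unitVal _))))))
end

theorem numeral_rename (r : ℕ → ℕ) : ∀ n, (PCF.numeral n).rename r = PCF.numeral n
  | 0 => rfl
  | n + 1 => by simp [PCF.numeral, PCF.Val.rename, numeral_rename r n]

theorem numeral_subst (s : ℕ → PCF.Val) : ∀ n, (PCF.numeral n).subst s = PCF.numeral n
  | 0 => rfl
  | n + 1 => by simp [PCF.numeral, PCF.Val.subst, numeral_subst s n]

theorem liftRen_lookup {α : Type*} {Γ Δ : List α} {r : ℕ → ℕ} (U : α)
    (hr : ∀ i T, Γ[i]? = some T → Δ[r i]? = some T) :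
    ∀ i T, (U :: Γ)[i]? = some T → (U :: Δ)[liftRen r i]? = some T
  | 0, _, h => h
  | i + 1, T, h => hr i T h

theorem liftRen_eq (r : ℕ → ℕ) : PCF.liftRen r = liftRen r := by
  funext i; cases i <;> rfl

mutual
theorem SimVal.rename {S : Signature} {σ : S.Op} : {Γ Δ : List PCF.Ty} → {V : PCF.Val} →
    {T : PCF.Ty} → {W : Val S} → {r : ℕ → ℕ} → SimVal σ Γ V T W →
    (∀ i T, Γ[i]? = some T → Δ[r i]? = some T) → SimVal σ Δ (V.rename r) T (W.rename r)
  | _, _, _, _, _, r, .zero, _ => by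
    rw [(scoped_zeroVal _ 0).rename_eq]; exact .zero
  | _, _, _, _, _, r, .succ h, hr => by
    have := SimVal.succ (h.rename hr)
    simp only [Val.rename_rename] at this
    simp only [Val.rename, Comp.rename, Val.rename_rename]
    exact this
  | _, _, _, _, _, _, .var h, hr => .var (hr _ _ h)
  | _, _, _, _, _, r, .lam h, hr => by
    simp only [PCF.Val.rename, liftRen_eq]
    exact .lam (h.rename (liftRen_lookup _ hr))
  | _, _, _, _, _, r, .fix h, hr => by
    simp only [PCF.Val.rename, liftRen_eq]
    exact .fix (h.rename (liftRen_lookup _ hr))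
  | _, _, _, _, _, r, .numeral hn h, _ => by
    rw [h.closed.rename_eq, hn, numeral_rename]; exact .numeral rfl h
theorem SimComp.rename {S : Signature} {σ : S.Op} : {Γ Δ : List PCF.Ty} → {C : PCF.Comp} →
    {T : PCF.Ty} → {M : Comp S} → {r : ℕ → ℕ} → SimComp σ Γ C T M →
    (∀ i T, Γ[i]? = some T → Δ[r i]? = some T) → SimComp σ Δ (C.rename r) T (M.rename r)
  | _, _, _, _, _, _, .app h h', hr => .app (h.rename hr) (h'.rename hr)
  | _, _, _, _, _, _, .ret h, hr => .ret (h.rename hr)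
  | _, _, _, _, _, _, .letC h h', hr => by
    simp only [PCF.Comp.rename, liftRen_eq]
    exact .letC (h.rename hr) (h'.rename (liftRen_lookup _ hr))
  | _, _, _, _, _, r, .case T' hV hC hD, hr => by
    have := SimComp.case T' (hV.rename hr) (hC.rename hr) (hD.rename (liftRen_lookup _ hr))
    rw [Comp.rename_eq_subst r, Comp.rename_eq_subst (liftRen r), ← liftSub_var_comp,
      ← retClause_subst, ← opClause_subst, Val.rename_eq_subst] at this
    rw [Comp.rename_eq_subst]
    simp only [PCF.Comp.rename, liftRen_eq]
    exact this
end

theorem liftSub_sim {S : Signature} {σ : S.Op} {Γ Δ : List PCF.Ty} {s : ℕ → PCF.Val}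
    {s' : ℕ → Val S} (U : PCF.Ty) (hs : ∀ i T, Γ[i]? = some T → SimVal σ Δ (s i) T (s' i)) :
    ∀ i T, (U :: Γ)[i]? = some T →
      SimVal σ (U :: Δ) (PCF.liftSub s i) T (liftSub s' i)
  | 0, _, h => .var h
  | i + 1, T, h => (hs i T h).rename fun _ _ h => h

mutual
theorem SimVal.subst {S : Signature} {σ : S.Op} : {Γ Δ : List PCF.Ty} → {V : PCF.Val} →
    {T : PCF.Ty} → {W : Val S} → {s : ℕ → PCF.Val} → {s' : ℕ → Val S} → SimVal σ Γ V T W →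
    (∀ i T, Γ[i]? = some T → SimVal σ Δ (s i) T (s' i)) → SimVal σ Δ (V.subst s) T (W.subst s')
  | _, _, _, _, _, _, _, .zero, _ => by
    rw [zeroVal_subst]; exact .zero
  | _, _, _, _, _, s, s', .succ h, hs => by
    have := SimVal.succ (h.subst hs)
    simp only [Val.rename_subst] at this
    simp only [Val.subst, Comp.subst, Val.subst_rename, liftSub, Val.rename_rename]
    exact this
  | _, _, _, _, _, _, _, .var h, hs => hs _ _ h
  | _, _, _, _, _, _, _, .lam h, hs => .lam (h.subst (liftSub_sim _ hs))
  | _, _, _, _, _, _, _, .fix h, hs => .fix (h.subst (liftSub_sim _ hs))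
  | _, _, _, _, _, _, _, .numeral hn h, _ => by
    rw [h.closed.subst_eq, hn, numeral_subst]; exact .numeral rfl h
theorem SimComp.subst {S : Signature} {σ : S.Op} : {Γ Δ : List PCF.Ty} → {C : PCF.Comp} →
    {T : PCF.Ty} → {M : Comp S} → {s : ℕ → PCF.Val} → {s' : ℕ → Val S} → SimComp σ Γ C T M →
    (∀ i T, Γ[i]? = some T → SimVal σ Δ (s i) T (s' i)) → SimComp σ Δ (C.subst s) T (M.subst s')
  | _, _, _, _, _, _, _, .app h h', hs => .app (h.subst hs) (h'.subst hs)
  | _, _, _, _, _, _, _, .ret h, hs => .ret (h.subst hs)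
  | _, _, _, _, _, _, _, .letC h h', hs =>
    .letC (h.subst hs) (h'.subst (liftSub_sim _ hs))
  | _, _, _, _, _, _, _, .case T' hV hC hD, hs => by
    have := SimComp.case T' (hV.subst hs) (hC.subst hs) (hD.subst (liftSub_sim _ hs))
    rw [← retClause_subst, ← opClause_subst] at this
    exact this
end

/-- The substitutions `single V` and `single W` for closed `V` and `W` are related pointwise. -/
theorem SimVal.single {S : Signature} {σ : S.Op} {V : PCF.Val} {T : PCF.Ty} {W : Val S}
    (h : SimVal σ [] V T W) :
    ∀ i U, [T][i]? = some U → SimVal σ [] (PCF.single V i) U (HEPCF.single W i)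
  | 0, _, hU => by cases hU; exact h
  | _ + 1, _, hU => by simp at hU

/-! ### Evaluation of the case handler -/

/-- The value `λ p. p A B`, for closed `A` and `B`: the Church encoding of a pair, or of a case
distinction. -/
def choice {S : Signature} (A B : Val S) : Val S := .lam (app2 (.var 0) A B)

/-- A choice applied to `λ f, g. P` runs `P` with `A` for `f` and `B` for `g`. -/
theorem choice_steps {S : Signature} {A B : Val S} (hA : A.Scoped 0) (hB : B.Scoped 0)
    (P : Comp S) : Steps (.app (choice A B) (lam2 P))
      ((P.subst (liftSub (single A))).subst (single B)) := by
  refine .head (.beta _ _) ?_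
  simp only [app2, Comp.subst, Val.subst, hA.subst_eq, hB.rename_eq, hB.subst_eq]
  refine .head (.letStep _ (.beta _ _)) (.head (.letRet _ _) ?_)
  simp only [Comp.subst, Val.subst, hB.subst_eq]
  exact .single (.beta _ _)

/-- `handle H(C, D) X`, the central part of the translation of a case distinction. -/
def handleCase {S : Signature} (σ : S.Op) (T : Ty S) (C D X : Comp S) : Comp S :=
  .handle (retClause σ C) {σ} (fun _ => opClause σ T D) X

/-- The value `λ f, g. let z = f () in return(Z_T)`, which runs the first component of a choice for
its effects only. -/
def probe {S : Signature} (T : Ty S) : Val S :=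
  lam2 (.letC (.app (.var 1) (unitVal S)) (.ret (zeroVal T)))

/-- The value to which the operation clause of `H(C, D)` binds `n` when the handled operation has
the continuation `K`. If the handled computation counts to `m + 1`, then this value represents
`m`. -/
def predVal {S : Signature} (σ : S.Op) (T : Ty S) (C D K : Comp S) : Val S :=
  .lam (.letC (.letC (.app (.lam (handleCase σ T C D K)) (.num 0)) (.app (.var 0) (probe T)))
    (.ret (unitVal S)))

/-- The value `λ p. p Z (λ x. C)` to which `handle H(C, D) X` evaluates if `X` counts to zero. -/
def zeroChoice {S : Signature} (σ : S.Op) (C : Comp S) : Val S :=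
  choice (zeroVal (.arrow (.base S.unit) {σ} (.base S.unit))) (.lam C)

/-- The value `λ p. p (λ x. σ((); z. N ())) (λ x. D[N/n])` to which `handle H(C, D) X` evaluates if
`X` counts to a successor; the value `N` represents the predecessor. -/
def succChoice {S : Signature} (σ : S.Op) (D : Comp S) (N : Val S) : Val S :=
  choice (.lam (.op σ (unitVal S) (.app N (unitVal S)))) (.lam (D.subst (single N)))

section CaseHandler

variable {S : Signature} {σ : S.Op} {T : Ty S} {C D K X : Comp S} {N : Val S}

theorem scoped_handleCase {k : ℕ} (hC : C.Scoped 0) (hD : D.Scoped 1) (hX : X.Scoped k) :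
    (handleCase σ T C D X).Scoped k :=
  .handle (.retClause σ fun _ _ _ => hC _ _ (by simp))
    (fun _ => .opClause σ T fun _ _ h => hD _ _ fun i hi => h i (by omega)) hX

theorem scoped_probe (k : ℕ) : (probe T).Scoped k :=
  .lam (.ret (.lam (.letC (.app (Val.scoped_var (by omega)) (scoped_unitVal _))
    (.ret (scoped_zeroVal _ _)))))

theorem scoped_predVal (hC : C.Scoped 0) (hD : D.Scoped 1) (hK : K.Scoped 1) :
    (predVal σ T C D K).Scoped 0 :=
  .lam (.letC (.letC (.app (.lam (scoped_handleCase hC hD fun _ _ h =>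
      hK _ _ fun i hi => h i (by omega))) (Val.scoped_num _ _))
    (.app (Val.scoped_var (by omega)) (scoped_probe _))) (.ret (scoped_unitVal _)))

theorem Comp.Scoped.subst_single (hD : D.Scoped 1) (hN : N.Scoped 0) :
    (D.subst (single N)).Scoped 0 := by
  intro s t _
  rw [D.subst_subst, D.subst_subst]
  refine hD _ _ fun i hi => ?_
  obtain rfl : i = 0 := by omega
  exact hN s t (by simp)

theorem handleCase_subst (hC : C.Scoped 0) (hD : D.Scoped 1) (s : ℕ → Val S) :
    (handleCase σ T C D X).subst s = handleCase σ T C D (X.subst s) := by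
  simp only [handleCase, Comp.subst, retClause_subst, opClause_subst, hC.subst_eq,
    hD.subst_liftSub]

theorem handleCase_ret (hC : C.Scoped 0) (V : Val S) :
    Steps (handleCase σ T C D (.ret V)) (.ret (zeroChoice σ C)) := by
  refine .head (.handleRet _ _ _ _) ?_
  simp only [retClause, app2, Comp.subst, Val.subst, Val.rename, hC.rename_eq, zeroVal_subst,
    zeroChoice, choice, liftSub, hC.subst_eq]
  exact .refl

theorem handleCase_op (hC : C.Scoped 0) (hD : D.Scoped 1) (hK : K.Scoped 1) (V : Val S) :
    Steps (handleCase σ T C D (.op σ V K)) (.ret (succChoice σ D (predVal σ T C D K))) := by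
  refine .head (.handleOp _ _ _ ⟨σ, Finset.mem_singleton_self σ⟩ _ _) ?_
  have hR : (retClause σ C).rename (liftRen Nat.succ) = retClause σ C := by
    rw [Comp.rename_eq_subst, ← liftSub_var_comp, retClause_subst, hC.subst_eq]
  have hH : (opClause σ T D).rename (liftRen (liftRen Nat.succ)) = opClause σ T D := by
    rw [Comp.rename_eq_subst, ← liftSub_var_comp, ← liftSub_var_comp, opClause_subst,
      hD.subst_liftSub]
  simp only [hR, hH]
  change Steps ((opClause σ T D).subst (pair (.lam (handleCase σ T C D K)) V)) _
  have hr : (Val.lam (handleCase σ T C D K)).Scoped 0 := .lam (scoped_handleCase hC hD hK)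
  -- Substituting the resumption for `r` turns the definition of `n` in the clause into `predVal`.
  have hN : (Val.lam (.letC (app2 (.var 1) (.num 0) (probe T)) (.ret (unitVal S)))).subst
      (pair (.lam (handleCase σ T C D K)) V) = predVal σ T C D K := by
    simp only [predVal, app2, Val.subst, Comp.subst, liftSub, pair, (scoped_probe 0).rename_eq,
      (scoped_probe 0).subst_eq, unitVal_subst, hr.rename_eq]
  have hN' := scoped_predVal (σ := σ) (T := T) hC hD hK
  have hO : (opClause σ T D).subst (pair (.lam (handleCase σ T C D K)) V) =
      .letC (.ret (predVal σ T C D K)) ((Comp.ret (.lam (app2 (.var 0)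
        (.lam (.op σ (unitVal S) (.app (.var 3) (unitVal S))))
        (.lam (D.rename (fun i => if i = 0 then 2 else i + 4)))))).subst
          (liftSub (pair (.lam (handleCase σ T C D K)) V))) := by
    rw [← hN]; rfl
  rw [hO]
  refine .head (.letRet _ _) ?_
  -- From here on only the closedness of this value matters.
  generalize predVal σ T C D K = N at hN'
  simp only [app2, Comp.subst, Val.subst, Val.rename, liftSub, succChoice, choice, unitVal_subst,
    single, hN'.rename_eq, (hD.subst_single hN').rename_eq, Comp.subst_rename, Comp.subst_subst]
  rw [hD _ (single N)]
  intro i hi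
  obtain rfl : i = 0 := by omega
  simp only [liftRen, liftSub, Val.subst, Val.rename, single, hN'.rename_eq, if_pos]

/-- Two enclosing `let`s that discard the result do not change the operations performed, and the
outer one restores the result `()`. The handler clause for `n` has this shape. -/
theorem Counts.letC_letC {n : ℕ} (h : Counts σ n X) (W : Val S) (hW : W.Scoped 0) :
    Counts σ n (.letC (.letC X (.ret W)) (.ret (unitVal S))) := by
  induction n generalizing X with
  | zero =>
    refine ((Steps.letC _ h).letC _).trans (.head (.letStep _ (.letRet _ _)) ?_)
    exact .single (.letRet _ _)
  | succ n ih =>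
    obtain ⟨K, hXK, hK, hn⟩ := h
    refine ⟨.letC (.letC K (.ret W)) (.ret (unitVal S)), ?_,
      .letC (.letC hK (.ret (hW.of_closed _))) (.ret (scoped_unitVal _)), ?_⟩
    · refine ((Steps.letC _ hXK).letC _).trans (.head (.letStep _ (.letOp _ _ _ _)) ?_)
      simp only [Comp.rename, hW.rename_eq]
      exact .single (.letOp _ _ _ _)
    · simpa only [Comp.subst, hW.subst_eq, unitVal_subst] using ih hn

/-- If the rest of the computation, handled again, evaluates to a choice whose first component
represents `n`, then the value bound to `n` by the operation clause represents the same number. -/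
theorem represents_predVal (hC : C.Scoped 0) (hD : D.Scoped 1) (hK : K.Scoped 1) {n : ℕ}
    {A B : Val S} (hA : Represents σ n A) (hB : B.Scoped 0)
    (h : Steps (handleCase σ T C D (K.subst (single (.num 0)))) (.ret (choice A B))) :
    Represents σ n (predVal σ T C D K) := by
  refine ⟨scoped_predVal hC hD hK, ?_⟩
  refine Counts.of_steps ?_ (hA.counts.letC_letC _ (scoped_zeroVal T 0))
  refine .head (.beta _ _) ?_
  simp only [Comp.subst, Val.subst, handleCase_subst hC hD, hK.subst_liftSub,
    (scoped_probe 0).subst_eq, unitVal_subst]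
  refine Steps.letC _ (.head (.letStep _ (.beta _ _)) ?_)
  rw [handleCase_subst hC hD]
  refine (Steps.letC _ h).trans (.head (.letRet _ _) ?_)
  simp only [Comp.subst, (scoped_probe 0).subst_eq]
  refine (choice_steps hA.closed hB _).trans ?_
  simp only [Comp.subst, Val.subst, zeroVal_subst, unitVal_subst, liftSub, single,
    hA.closed.rename_eq, hA.closed.subst_eq]
  exact .refl

theorem represents_zeroVal : Represents σ 0 (zeroVal (.arrow (.base S.unit) {σ} (.base S.unit))) :=
  ⟨scoped_zeroVal _ 0, .single (.beta _ _)⟩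

theorem Represents.succ {n : ℕ} (hN : Represents σ n N) :
    Represents σ (n + 1) (.lam (.op σ (unitVal S) (.app N (unitVal S)))) := by
  refine ⟨.lam (.op (scoped_unitVal _) (.app (hN.closed.of_closed _) (scoped_unitVal _))),
    .app N (unitVal S), .single ?_, .app (hN.closed.of_closed _) (scoped_unitVal _), ?_⟩
  · simpa only [Comp.subst, hN.closed.subst_eq, unitVal_subst] using
      Step.beta (.op σ (unitVal S) (.app N (unitVal S))) (unitVal S)
  · simpa only [Comp.subst, hN.closed.subst_eq, unitVal_subst] using hN.counts

/-- The value of `handle H(C, D) X` if `X` counts to `n`. The induction is needed because the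
predecessor is computed by running the handler again on the rest of `X`: by the induction hypothesis
this gives a choice whose first component represents the predecessor. -/
theorem handleCase_counts (hC : C.Scoped 0) (hD : D.Scoped 1) {n : ℕ} (hX : Counts σ n X) :
    match n with
    | 0 => Steps (handleCase σ T C D X) (.ret (zeroChoice σ C))
    | m + 1 => ∃ N, Represents σ m N ∧
        Steps (handleCase σ T C D X) (.ret (succChoice σ D N)) := by
  induction n generalizing X with
  | zero => exact (Steps.handle _ _ _ hX).trans (handleCase_ret hC _)
  | succ m ih =>
    obtain ⟨K, hXK, hK, hm⟩ := hX
    refine ⟨predVal σ T C D K, ?_, (Steps.handle _ _ _ hXK).trans (handleCase_op hC hD hK _)⟩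
    have := ih hm
    cases m with
    | zero =>
      exact represents_predVal hC hD hK represents_zeroVal (.lam fun _ _ _ => hC _ _ (by simp)) this
    | succ m =>
      obtain ⟨N, hN, hs⟩ := this
      exact represents_predVal hC hD hK hN.succ
        (.lam fun _ _ _ => (hD.subst_single hN.closed) _ _ (by simp)) hs

end CaseHandler

/-! ### Simulation of PCF reductions -/

/-- A closed PCF value of type `Nat` is a numeral, and every value that simulates it represents the
same number. -/
theorem SimVal.represents {S : Signature} {σ : S.Op} : {Γ : List PCF.Ty} → {V : PCF.Val} →
    {T : PCF.Ty} → {W : Val S} → SimVal σ Γ V T W → Γ = [] → T = .nat →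
    ∃ n, V = PCF.numeral n ∧ Represents σ n W
  -- The indices are kept general, with equations for them, to allow recursion on the derivation.
  | _, _, _, _, .zero, _, _ => ⟨0, rfl, represents_zeroVal⟩
  | _, _, _, _, .succ h, hΓ, _ => by
    obtain ⟨n, rfl, hn⟩ := h.represents hΓ rfl
    exact ⟨n + 1, rfl, by rw [hn.closed.rename_eq]; exact hn.succ⟩
  | _, _, _, _, .var h, hΓ, _ => by simp [hΓ] at h
  | _, _, _, _, .numeral hV h, _, _ => ⟨_, hV, h⟩

/-- A well-typed closed PCF computation returns a value or can be reduced. -/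
theorem SimComp.progress {S : Signature} {σ : S.Op} : {Γ : List PCF.Ty} → {C : PCF.Comp} →
    {T : PCF.Ty} → {M : Comp S} → SimComp σ Γ C T M → Γ = [] →
    (∃ V, C = .ret V) ∨ ∃ C', PCF.Step C C'
  | _, _, _, _, .app h _, hΓ => by
    right
    cases h with
    | var h => simp [hΓ] at h
    | lam => exact ⟨_, .beta _ _⟩
    | fix => exact ⟨_, .fix _ _⟩
  | _, _, _, _, .ret _, _ => .inl ⟨_, rfl⟩
  | _, _, _, _, .letC h _, hΓ => by
    right
    rcases h.progress hΓ with ⟨V, rfl⟩ | ⟨C', h'⟩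
    · exact ⟨_, .letRet _ _⟩
    · exact ⟨_, .letStep _ h'⟩
  | _, _, _, _, .case _ h _ _, hΓ => by
    right
    obtain ⟨n, rfl, -⟩ := h.represents hΓ rfl
    cases n with
    | zero => exact ⟨_, .caseZero _ _⟩
    | succ n => exact ⟨_, .caseSucc _ _ _⟩

/-- The outer part `let a = X in a (λ f, g. g ())` of the translated case distinction runs the
branch stored in the second component. -/
theorem choice_select_steps {S : Signature} {A : Val S} {C X : Comp S} (hA : A.Scoped 0)
    (hC : C.Scoped 0) (h : Steps X (.ret (choice A (.lam C)))) :
    Relation.TransGen Step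
      (.letC X (.app (.var 0) (lam2 (.app (.var 0) (unitVal S))))) C := by
  have hC' : (Val.lam C).Scoped 0 := .lam fun _ _ _ => hC _ _ (by simp)
  refine .tail' (b := .app (.lam C) (unitVal S)) ?_ ?_
  · refine (h.letC _).trans (.head (.letRet _ _) ?_)
    have h := choice_steps hA hC' (.app (.var 0) (unitVal S))
    simp only [Comp.subst, Val.subst, unitVal_subst, liftSub, single, lam2] at h ⊢
    exact h
  · simpa only [hC.subst_eq] using Step.beta C (unitVal S)

/-- Every reduction step of a closed PCF computation is simulated by at least one step. -/
theorem SimComp.step {S : Signature} {σ : S.Op} {C C' : PCF.Comp} {T : PCF.Ty} {M : Comp S}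
    (h : SimComp σ [] C T M) (hs : PCF.Step C C') :
    ∃ M', Relation.TransGen Step M M' ∧ SimComp σ [] C' T M' := by
  induction hs generalizing T M with
  | beta C W =>
    cases h with
    | app h h' => cases h with
      | lam h => exact ⟨_, .single (.beta _ _), h.subst h'.single⟩
  | fix V W =>
    cases h with
    | app h h' => cases h with
      | fix h => exact ⟨_, .single (.fix _ _), .app (h.subst (SimVal.fix h).single) h'⟩
  | caseZero C D =>
    cases h with
    | case T' hV hC hD =>
      obtain ⟨n, hn, hW⟩ := hV.represents rfl rfl
      cases n with
      | succ n => cases hn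
      | zero =>
        exact ⟨_, choice_select_steps (scoped_zeroVal _ 0) hC.scoped
          (handleCase_counts hC.scoped hD.scoped hW.counts), hC⟩
  | caseSucc V C D =>
    cases h with
    | case T' hV hC hD =>
      obtain ⟨n, hn, hW⟩ := hV.represents rfl rfl
      cases n with
      | zero => cases hn
      | succ n =>
        obtain ⟨N, hN, hs⟩ := handleCase_counts (T := T') hC.scoped hD.scoped hW.counts
        cases hn
        exact ⟨_, choice_select_steps hN.succ.closed
          (Comp.Scoped.subst_single hD.scoped hN.closed) hs,
          hD.subst (SimVal.numeral rfl hN).single⟩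
  | letRet V D =>
    cases h with
    | letC h h' => cases h with
      | ret h => exact ⟨_, .single (.letRet _ _), h'.subst h.single⟩
  | letStep D _ ih =>
    cases h with
    | letC h h' =>
      obtain ⟨M', hM, hC⟩ := ih h
      exact ⟨_, Relation.TransGen.lift (fun C => Comp.letC C _) (fun _ _ h => Step.letStep _ h)
        _ _ hM, .letC hC h'⟩

theorem SimComp.steps {S : Signature} {σ : S.Op} {C C' : PCF.Comp} {T : PCF.Ty} {M : Comp S}
    (h : SimComp σ [] C T M) (hs : Relation.ReflTransGen PCF.Step C C') :
    ∃ M', Steps M M' ∧ SimComp σ [] C' T M' := by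
  induction hs with
  | refl => exact ⟨M, .refl, h⟩
  | tail _ hs ih =>
    obtain ⟨M', hM, h'⟩ := ih
    obtain ⟨M'', hM', h''⟩ := h'.step hs
    exact ⟨M'', hM.trans hM'.to_reflTransGen, h''⟩

/-- Divergence is reflected: if every reduct of `C` can be reduced, then no reduct of a simulating
computation, placed in an evaluation context `let`, is a normal form. -/
theorem SimComp.diverges {S : Signature} {σ : S.Op} {C : PCF.Comp} {T : PCF.Ty} {M K N : Comp S}
    (h : SimComp σ [] C T M) (hC : ¬ ∃ N, PCF.IsNormalFormOf N C) :
    ¬ IsNormalFormOf N (.letC M K) := by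
  rintro ⟨hN, hnf⟩
  let P (X : Comp S) : Prop := ∃ C' M', Relation.ReflTransGen PCF.Step C C' ∧
    SimComp σ [] C' T M' ∧ Steps X (.letC M' K)
  have key (X : Comp S) : P X → ∃ Y, Step X Y ∧ P Y := by
    rintro ⟨C', M', hC', hM', hX⟩
    obtain ⟨D, hD⟩ : ∃ D, PCF.Step C' D := by
      by_contra hD
      exact hC ⟨C', hC', fun D h => hD ⟨D, h⟩⟩
    obtain ⟨M'', hM, hD'⟩ := hM'.step hD
    obtain ⟨Y, hY, hY'⟩ := Relation.TransGen.head'_iff.1 (Relation.TransGen.trans_right hX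
      (Relation.TransGen.lift (fun C => Comp.letC C K) (fun _ _ h => Step.letStep _ h) _ _ hM))
    exact ⟨Y, hY, D, M'', hC'.tail hD, hD', hY'⟩
  -- By determinism the reduct provided by `key` is the only one, so `P` holds along all reductions.
  have hP : P N := by
    clear hnf
    induction hN with
    | refl => exact ⟨C, M, .refl, h, .refl⟩
    | tail _ hs ih =>
      obtain ⟨Y, hY, hPY⟩ := key _ ih
      rwa [hs.deterministic hY]
  obtain ⟨Y, hY, -⟩ := key N hP
  exact hnf Y hY

/-! ### Effect trees -/

theorem effectTree_eq {S : Signature} {C : Comp S} {x : (treeFunctor S).Obj (Comp S ⊕ S.Const)}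
    (h : unfold (.inl C) = x) : effectTree C = PFunctor.M.mk (F := treeFunctor S)
      ((treeFunctor S).map (PFunctor.M.corec (F := treeFunctor S) unfold) x) :=
  (PFunctor.M.corec_def (F := treeFunctor S) _ _).trans (by rw [h])

theorem effectTree_ret {S : Signature} {C : Comp S} {V : Val S} (h : Steps C (.ret V)) :
    effectTree C = .ret V := by
  have h' : ∃ V, Steps C (.ret V) := ⟨V, h⟩
  have hV : h'.choose = V := by
    simpa using Steps.normal_unique (not_step_ret _) (not_step_ret _) h h'.choose_spec
  have hu : unfold (.inl C) = ⟨.ret V, Fin.elim0⟩ := (dif_pos h').trans (congrArg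
    (fun V => (⟨.ret V, Fin.elim0⟩ : (treeFunctor S).Obj (Comp S ⊕ S.Const))) hV)
  exact (effectTree_eq hu).trans (congrArg (fun f => PFunctor.M.mk (F := treeFunctor S) ⟨.ret V, f⟩)
    (funext fun i => Fin.elim0 i))

theorem effectTree_op {S : Signature} {C K : Comp S} {σ : S.Op} {c : S.Const}
    (h : Steps C (.op σ (.const c) K)) : effectTree C =
      .op σ (.const c) fun i => effectTree (K.subst (single (.num i))) := by
  have h₁ : ¬ ∃ V, Steps C (.ret V) := by
    rintro ⟨V, hV⟩
    cases Steps.normal_unique (not_step_ret _) (not_step_op _ _ _) hV h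
  have h₂ : ∃ q : S.Op × S.Const × Comp S, Steps C (.op q.1 (.const q.2.1) q.2.2) :=
    ⟨(σ, c, K), h⟩
  -- Normal forms are unique, so the choice made in `unfold` is the given one.
  have hq : h₂.choose = (σ, c, K) := by
    have := Steps.normal_unique (not_step_op _ _ _) (not_step_op _ _ _) h h₂.choose_spec
    simp only [Comp.op.injEq, Val.const.injEq] at this
    obtain ⟨h, h', h''⟩ := this
    exact Prod.ext h (Prod.ext h' h'')
  have hu : unfold (.inl C) = ⟨.op σ, Fin.cons
      (α := fun _ : Fin (S.opArity σ + 1) => Comp S ⊕ S.Const) (.inr c)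
      fun i => .inl (K.subst (single (.num i)))⟩ :=
    (dif_neg h₁).trans ((dif_pos h₂).trans (congrArg (fun q : S.Op × S.Const × Comp S =>
      (⟨.op q.1, Fin.cons (α := fun _ : Fin (S.opArity q.1 + 1) => Comp S ⊕ S.Const) (.inr q.2.1)
        fun i => .inl (q.2.2.subst (single (.num i)))⟩ :
          (treeFunctor S).Obj (Comp S ⊕ S.Const))) hq))
  refine (effectTree_eq hu).trans (congrArg
    (fun f => PFunctor.M.mk (F := treeFunctor S) ⟨.op σ, f⟩) (funext fun i => ?_))
  refine Fin.cases ?_ (fun i => rfl) i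
  exact (PFunctor.M.corec_def (F := treeFunctor S) _ _).trans (congrArg
    (fun f => PFunctor.M.mk (F := treeFunctor S) ⟨.const c, f⟩) (funext fun i => Fin.elim0 i))

theorem effectTree_bot {S : Signature} {C : Comp S} (h : ¬ ∃ N, IsNormalFormOf N C) :
    effectTree C = .bot := by
  have h₁ : ¬ ∃ V, Steps C (.ret V) := fun ⟨V, hV⟩ => h ⟨_, hV, not_step_ret V⟩
  have h₂ : ¬ ∃ q : S.Op × S.Const × Comp S, Steps C (.op q.1 (.const q.2.1) q.2.2) :=
    fun ⟨q, hq⟩ => h ⟨_, hq, not_step_op _ _ _⟩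
  have hu : unfold (.inl C) = ⟨.bot, Fin.elim0⟩ := (dif_neg h₁).trans (dif_neg h₂)
  exact (effectTree_eq hu).trans (congrArg (fun f => PFunctor.M.mk (F := treeFunctor S) ⟨.bot, f⟩)
    (funext fun i => Fin.elim0 i))

theorem Counts.effectTree_eq {S : Signature} {σ : S.Op} (harity : S.opArity σ = 1) {n : ℕ}
    {C : Comp S} (h : Counts σ n C) : effectTree C = numTree σ n := by
  induction n generalizing C with
  | zero => exact effectTree_ret h
  | succ n ih =>
    obtain ⟨K, hK, -, hn⟩ := h
    rw [effectTree_op hK, numTree]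
    congr 1
    funext i
    have hi : (i : ℕ) = 0 := by have := i.isLt; omega
    rw [hi]
    exact ih hn

/-! ### Typing of the translation -/

mutual
theorem ValTy.rename {S : Signature} : {Γ Δ : List (Ty S)} → {V : Val S} → {T : Ty S} →
    {r : ℕ → ℕ} → ValTy Γ V T → (∀ i T, Γ[i]? = some T → Δ[r i]? = some T) →
    ValTy Δ (V.rename r) T
  | _, _, _, _, _, .const c, _ => .const c
  | _, _, _, _, _, .num h, _ => .num h
  | _, _, _, _, _, .var h, hr => .var (hr _ _ h)
  | _, _, _, _, _, .lam h, hr => .lam (h.rename (liftRen_lookup _ hr))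
  | _, _, _, _, _, .fix h, hr => .fix (h.rename (liftRen_lookup _ hr))
theorem CompTy.rename {S : Signature} : {Γ Δ : List (Ty S)} → {E : Finset S.Op} → {C : Comp S} →
    {T : Ty S} → {r : ℕ → ℕ} → CompTy Γ E C T → (∀ i T, Γ[i]? = some T → Δ[r i]? = some T) →
    CompTy Δ E (C.rename r) T
  | _, _, _, _, _, _, .app h h', hr => .app (h.rename hr) (h'.rename hr)
  | _, _, _, _, _, _, .op hσ h h', hr =>
    .op hσ (h.rename hr) (h'.rename (liftRen_lookup _ hr))
  | _, _, _, _, _, _, .ret h, hr => .ret (h.rename hr)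
  | _, _, _, _, _, _, .letC h h', hr => .letC (h.rename hr) (h'.rename (liftRen_lookup _ hr))
  | _, _, _, _, _, _, .handle hR hH hC, hr =>
    .handle (hR.rename (liftRen_lookup _ hr))
      (fun τ => (hH τ).rename (liftRen_lookup _ (liftRen_lookup _ hr))) (hC.rename hr)
  | _, _, _, _, _, _, .case h hC, hr => .case (h.rename hr) fun i => (hC i).rename hr
end

theorem unitVal_typed {S : Signature} (Γ : List (Ty S)) : ValTy Γ (unitVal S) (.base S.unit) := by
  have := ValTy.const (Γ := Γ) S.star
  rwa [S.star_ty] at this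

theorem zeroVal_typed {S : Signature} (σ : S.Op) :
    ∀ (T : PCF.Ty) (Γ : List (Ty S)), ValTy Γ (zeroVal (transTy σ T)) (transTy σ T)
  | .nat, _ => .lam (.ret (unitVal_typed _))
  | .arrow _ U, _ => .lam (.ret (zeroVal_typed σ U _))

theorem lam2_typed {S : Signature} {Γ : List (Ty S)} {E E' : Finset S.Op} {C : Comp S}
    {T T' U : Ty S} (h : CompTy (T' :: T :: Γ) E C U) :
    ValTy Γ (lam2 C) (.arrow T E' (.arrow T' E U)) :=
  .lam (.ret (.lam h))

theorem app2_typed {S : Signature} {Γ : List (Ty S)} {E : Finset S.Op} {V W₁ W₂ : Val S}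
    {T T' U : Ty S} (hV : ValTy Γ V (.arrow T E (.arrow T' E U))) (h₁ : ValTy Γ W₁ T)
    (h₂ : ValTy Γ W₂ T') : CompTy Γ E (app2 V W₁ W₂) U :=
  .letC (.app hV h₁) (.app (.var rfl) (h₂.rename fun _ _ h => h))

/-- The type of the arguments `λ f, g. P` of a choice that returns results of type `T`. -/
def choiceTy {S : Signature} (σ : S.Op) (T : Ty S) : Ty S :=
  .arrow (.arrow (.base S.unit) {σ} (.base S.unit)) {σ}
    (.arrow (.arrow (.base S.unit) {σ} T) {σ} T)

theorem retClause_typed {S : Signature} {σ : S.Op} {Γ : List (Ty S)} {C : Comp S} {T U : Ty S}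
    (h : CompTy Γ {σ} C T) :
    CompTy (U :: Γ) {σ} (retClause σ C) (.arrow (choiceTy σ T) {σ} T) :=
  .ret (.lam (app2_typed (T := .arrow (.base S.unit) {σ} (.base S.unit))
    (T' := .arrow (.base S.unit) {σ} T) (.var rfl) (.lam (.ret (unitVal_typed _)))
    (.lam (h.rename fun _ _ h => h))))

theorem opClause_typed {S : Signature} {σ : S.Op} (hparam : S.opParam σ = S.unit)
    (harity : S.opArity σ = 1) {Γ : List (Ty S)} {D : Comp S} {T : PCF.Ty}
    (h : CompTy (transTy σ .nat :: Γ) {σ} D (transTy σ T)) :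
    CompTy (.arrow (.enum (S.opArity σ)) {σ} (.arrow (choiceTy σ (transTy σ T)) {σ} (transTy σ T))
      :: .base (S.opParam σ) :: Γ) {σ} (opClause σ (transTy σ T) D)
      (.arrow (choiceTy σ (transTy σ T)) {σ} (transTy σ T)) := by
  refine .letC (U := transTy σ .nat) (.ret (.lam (.letC (U := transTy σ T)
    (app2_typed (T := .enum (S.opArity σ)) (T' := choiceTy σ (transTy σ T)) (.var rfl)
      (.num (by omega)) (lam2_typed (.letC (.app (.var rfl) (unitVal_typed _))
        (.ret (zeroVal_typed σ T _))))) (.ret (unitVal_typed _)))))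
    (.ret (.lam (app2_typed (T := transTy σ .nat) (T' := .arrow (.base S.unit) {σ} (transTy σ T))
      (.var rfl) (.lam (.op (Finset.mem_singleton_self σ) ?_
        (.app (.var rfl) (unitVal_typed _)))) (.lam (h.rename ?_)))))
  · rw [hparam]; exact unitVal_typed _
  · intro i U hU
    cases i with
    | zero => exact hU
    | succ i => simpa using hU

mutual
theorem transVal_typed {S : Signature} {σ : S.Op} (hparam : S.opParam σ = S.unit)
    (harity : S.opArity σ = 1) : {Γ : List PCF.Ty} → {V : PCF.Val} → {T : PCF.Ty} →
    (d : PCF.ValTy Γ V T) → ValTy (Γ.map (transTy σ)) (transVal σ d) (transTy σ T)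
  | _, _, _, .zero => zeroVal_typed σ .nat _
  | _, _, _, .succ d => .lam (.op (Finset.mem_singleton_self σ)
      (by rw [hparam]; exact unitVal_typed _)
      (.app ((transVal_typed hparam harity d).rename fun _ _ h => h) (unitVal_typed _)))
  | _, _, _, .var h => .var (by simp [h])
  | _, _, _, .lam d => .lam (transComp_typed hparam harity d)
  | _, _, _, .fix d => .fix (transVal_typed hparam harity d)
theorem transComp_typed {S : Signature} {σ : S.Op} (hparam : S.opParam σ = S.unit)
    (harity : S.opArity σ = 1) : {Γ : List PCF.Ty} → {C : PCF.Comp} → {T : PCF.Ty} →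
    (d : PCF.CompTy Γ C T) → CompTy (Γ.map (transTy σ)) {σ} (transComp σ d) (transTy σ T)
  | _, _, _, .app d e => .app (transVal_typed hparam harity d) (transVal_typed hparam harity e)
  | _, _, _, .ret d => .ret (transVal_typed hparam harity d)
  | _, _, _, .letC d e =>
    .letC (transComp_typed hparam harity d) (transComp_typed hparam harity e)
  | _, _, _, .case (T := T) dV dC dD =>
    .letC (U := .arrow (choiceTy σ (transTy σ T)) {σ} (transTy σ T))
      (.handle (retClause_typed (transComp_typed hparam harity dC))
        (fun ⟨τ, hτ⟩ => by
          obtain rfl := Finset.mem_singleton.1 hτ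
          exact opClause_typed hparam harity (transComp_typed hparam harity dD))
        (.app (transVal_typed hparam harity dV) (unitVal_typed _)))
      (.app (.var rfl) (lam2_typed (.app (.var rfl) (unitVal_typed _))))
end

end HEPCF

theorem mainTheorem4 (S : HEPCF.Signature) (σ : S.Op)
    (hparam : S.opParam σ = S.unit) (harity : S.opArity σ = 1)
    (C : PCF.Comp) (d : PCF.CompTy [] C PCF.Ty.nat) :
    HEPCF.CompTy [] {σ} (HEPCF.finalComp σ d) (HEPCF.Ty.base S.unit) ∧
    (∀ N : PCF.Comp, PCF.IsNormalFormOf N C →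
      ∃ n : ℕ, N = PCF.Comp.ret (PCF.numeral n) ∧
        HEPCF.effectTree (HEPCF.finalComp σ d) = HEPCF.numTree σ n) ∧
    ((¬ ∃ N : PCF.Comp, PCF.IsNormalFormOf N C) →
      (¬ ∃ N : HEPCF.Comp S, HEPCF.IsNormalFormOf N (HEPCF.finalComp σ d)) ∧
        HEPCF.effectTree (HEPCF.finalComp σ d) = HEPCF.Tree.bot) := by
  have hsim := HEPCF.simComp_trans σ d
  refine ⟨.letC (HEPCF.transComp_typed hparam harity d)
    (.app (.var rfl) (HEPCF.unitVal_typed _)), ?_, fun hC => ?_⟩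
  · rintro N ⟨hN, hnf⟩
    obtain ⟨M, hM, hNM⟩ := hsim.steps hN
    rcases hNM.progress rfl with ⟨V, rfl⟩ | ⟨D, hD⟩
    · cases hNM with
      | ret h =>
        obtain ⟨n, rfl, hn⟩ := h.represents rfl rfl
        refine ⟨n, rfl, (hn.counts.of_steps ?_).effectTree_eq harity⟩
        exact (hM.letC _).trans (.single (.letRet _ _))
    · exact absurd hD (hnf D)
  · have h : ¬ ∃ N, HEPCF.IsNormalFormOf N (HEPCF.finalComp σ d) :=
      fun ⟨N, hN⟩ => hsim.diverges hC hN
    exact ⟨h, HEPCF.effectTree_bot h⟩
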